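/- **Setting.** Fix $d$. Sensors are at positions $x_1,\dots,x_N\in\mathbb R^d$, and $\mathcal G=(\mathcal V,\mathcal E)$ is the undirected graph on $\{1,\dots,N\}$ in which $i\ne i'$ are linked iff $\|x_i-x_{i'}\|\le r$, where $r>0$. Command nodes are at positions $c_1,\dots,c_K\in\mathbb R^d$, $K\ge 1$, and have range $R$. Let $\mathcal G_j=(\mathcal V_j,\mathcal E_j)$ be the subgraph of $\mathcal G$ induced on the sensors $i$ with $\|x_i-c_j\|\le R$, and let $e_{\max}=\max_j|\mathcal E_j|$. In the command graph, $j\neq k$ are adjacent iff $\|c_j-c_k\|\le 2R$. **Planning.** Given a finite set $A$ of atomic propositions, a linear temporal logic (LTL) formula $\varphi$ over $A$, a set $Q_0$ of initial subsets of $A$ and a cost $c(q,q')\ge 0$ for every $q,q'\subseteq A$, the planner: (1) writes down the transition system whose states are all subsets of $A$, with one transition of weight $c(q,q')$ from each $q$ to each $q'$; (2) translates $\varphi$ into a nondeterministic Büchi automaton, by the construction with elementary sets of subformulas (a generalized Büchi automaton) followed by the counter construction; (3) forms the product of the two; (4) computes the strongly connected components and cheapest walks of the product, lists for every initial node $i_0$,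 every accepting node $f$ and every edge $f\to s$ inside a component the cheapest lasso that goes from $i_0$ to $f$ (prefix) and then repeats a walk from $s$ to $f$ (suffix), and returns the projection of a cheapest one of these lassos, a schedule $\tau_{\rm pre}[\tau_{\rm suf}]^\omega$; the cost of a lasso is the total weight of the transitions inside its prefix plus that of the transitions inside its suffix. If there is no such lasso, it reports this. The *centralized algorithm* runs the planner on $A=\mathcal E$ and $$\varphi=\bigwedge_{e\in\mathcal E}\Bigl(\square\bigl(e\Rightarrow\bigwedge_{e'\neq e,\ e'\cap e\neq\emptyset}\neg e'\bigr)\wedge\square\lozenge e\Bigr).$$ The *hierarchical algorithm* computes the command graph and then, for $j=1,\dots,K$: plans an activation schedule $\rho$ of the command nodes for $$\psi=\bigwedge_{j}\Bigl(\square\bigl(j\Rightarrow\bigwedge_{k\text{ adjacent to }j}\neg k\bigr)\wedge\square\lozenge j\Bigr)$$ (all transitions having cost $0$); compares it with the schedules held by those neighbours of $j$ that have already been processed, adopting a neighbour's schedule in case of a discrepancy; extracts $\mathcal E_j$ from $\mathcal E$ by testing whether the endpoints of the links are in range; and runs the centralized algorithm on $\mathcal E_j$, which gives $\tau_j$. It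 returns $\rho$ and the $\tau_j$, which represent the global schedule $\tau(t)=\bigcup_{j\in\rho(t)}\tau_j(t)$. **Time** is the number of steps on a unit-cost real RAM: visiting a list cell or a node of a formula, comparing two identifiers, and adding or comparing two costs take a step each, up to a constant factor; a distance in $\mathbb R^d$ takes $d+1$ steps; an evaluation of the cost or of the initial-state predicate takes one step more than the size of its arguments. The network is given to the algorithms as the list of its links. **Theorem.** Let $d$ be fixed. 1. There are constants $C,a,b$ (depending only on $d$) such that for all $N$, $K\ge1$, $r>0$, $R$, all positions $x_i$, $c_j$, all nonnegative costs and all sets of initial states, if there is $\epsilon\in(r,R)$ such that every $x_i$ lies in an open ball of radius $R-\epsilon$ around some $c_j$, then the hierarchical algorithm takes at most $C\,K\,2^{a\,e_{\max}+b\,K}$ steps. That is, its worst-case time is $O\bigl(K\,2^{O(e_{\max})+O(K)}\bigr)$. 2. There are constants $C,a$ such that for all sensor networks, nonnegative costs and sets of initial states the centralized algorithm takes at most $C\,2^{a|\mathcal E|}$ steps. That is, its worst-case time is $O\bigl(2^{O(|\mathcal E|)}\bigr)$. -/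

import Mathlib

open scoped NNReal

/-! # Locally non-interfering connectivity: the centralized and the hierarchical planner

Running times are counted on a unit-cost real RAM with linked lists. A program is a term of the
monad `Timed`, which carries a result together with the number of elementary steps spent on it.
The convention is as follows. Every cell of a list and every node of a formula that a program
visits costs at least one step, and so does every comparison of two identifiers (sensors,
links, command nodes, state numbers) and every addition or comparison of two costs. The distance
of two points of `ℝ^d` costs `d + 1` steps, and an evaluation of the cost function or of the set
of initial states costs one step more than the number of entries of its arguments. Between two
charges a program only builds or takes apart a bounded number of records and cells; every
traversal of a list or of a tree goes through the charged functions below. -/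

namespace LNC

/-! ## Step counting -/

/-- A result, with the number of elementary steps that were spent on computing it. -/
structure Timed (β : Type) where
  val : β
  steps : ℕ

namespace Timed

instance : Monad Timed where
  pure b := ⟨b, 0⟩
  bind m f := ⟨(f m.val).val, m.steps + (f m.val).steps⟩

/-- Spend `n` steps. -/
def tick (n : ℕ) : Timed Unit := ⟨(), n⟩

variable {β γ : Type}

/-- Concatenation of lists. -/
def append : List β → List β → Timed (List β)
  | [], l => do
    tick 1
    pure l
  | a :: k, l => do
    tick 1
    let m ← append k l
    pure (a :: m)

/-- Apply a program to every entry of a list. -/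
def map (f : β → Timed γ) : List β → Timed (List γ)
  | [] => do
    tick 1
    pure []
  | a :: l => do
    tick 1
    let b ← f a
    let m ← map f l
    pure (b :: m)

/-- Apply a program to every entry of a list and concatenate the results. -/
def flatMap (f : β → Timed (List γ)) : List β → Timed (List γ)
  | [] => do
    tick 1
    pure []
  | a :: l => do
    tick 1
    let b ← f a
    let m ← flatMap f l
    append b m

/-- Keep the entries of a list that pass a test. -/
def filter (p : β → Timed Bool) : List β → Timed (List β)
  | [] => do
    tick 1
    pure []
  | a :: l => do
    tick 1
    let b ← p a
    let m ← filter p l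
    pure (if b then a :: m else m)

/-- The first entry of a list that passes a test. -/
def find (p : β → Timed Bool) : List β → Timed (Option β)
  | [] => do
    tick 1
    pure none
  | a :: l => do
    tick 1
    let b ← p a
    if b then pure (some a) else find p l

/-- Does some entry of a list pass a test? -/
def any (p : β → Timed Bool) (l : List β) : Timed Bool := do
  let a ← find p l
  pure a.isSome

/-- A loop over the entries of a list, with an accumulator. -/
def foldl (f : γ → β → Timed γ) (c : γ) : List β → Timed γ
  | [] => do
    tick 1
    pure c
  | a :: l => do
    tick 1
    let c' ← f c a
    foldl f c' l

def reverse (l : List β) : Timed (List β) :=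
  foldl (fun m a => do
    tick 1
    pure (a :: m)) [] l

def length (l : List β) : Timed ℕ :=
  foldl (fun n _ => do
    tick 1
    pure (n + 1)) 0 l

/-- Number the entries of a list consecutively, from `n` on. -/
def number (n : ℕ) : List β → Timed (List (ℕ × β))
  | [] => do
    tick 1
    pure []
  | a :: l => do
    tick 1
    let m ← number (n + 1) l
    pure ((n, a) :: m)

/-- All sublists of a list: its subsets, when the list has no repetitions. -/
def sublists : List β → Timed (List (List β))
  | [] => do
    tick 1
    pure [[]]
  | a :: l => do
    tick 1
    let s ← sublists l
    let t ← map (fun k => do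
      tick 1
      pure (a :: k)) s
    append t s

/-- Comparison of two identifiers. -/
def eqId [DecidableEq β] (a b : β) : Timed Bool := do
  tick 1
  pure (decide (a = b))

/-- Comparison of two lists, entry by entry. -/
def eqList (eq : β → β → Timed Bool) : List β → List β → Timed Bool
  | [], [] => do
    tick 1
    pure true
  | a :: k, b :: l => do
    tick 1
    let v ← eq a b
    if v then eqList eq k l else pure false
  | _, _ => do
    tick 1
    pure false

end Timed

open Timed

/-! ## Linear temporal logic -/

/-- The formulas of linear temporal logic over the atomic propositions `α`. -/
inductive LTL (α : Type) : Type
  | tt : LTL α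
  | atom : α → LTL α
  | and : LTL α → LTL α → LTL α
  | not : LTL α → LTL α
  | next : LTL α → LTL α
  | untl : LTL α → LTL α → LTL α

namespace LTL

variable {α : Type}

def imp (f g : LTL α) : LTL α := not (and f (not g))

def eventually (f : LTL α) : LTL α := untl tt f

def always (f : LTL α) : LTL α := not (eventually (not f))

/-- The formula holds of the infinite word `w` at time `t`. -/
def Sat (w : ℕ → Set α) : ℕ → LTL α → Prop
  | _, tt => True
  | t, atom a => a ∈ w t
  | t, and f g => Sat w t f ∧ Sat w t g
  | t, not f => ¬ Sat w t f
  | t, next f => Sat w (t + 1) f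
  | t, untl f g => ∃ s, t ≤ s ∧ Sat w s g ∧ ∀ u, t ≤ u → u < s → Sat w u f

/-- The conjunction of a list of formulas. -/
def conj : List (LTL α) → Timed (LTL α)
  | [] => do
    tick 1
    pure tt
  | f :: l => do
    tick 1
    let g ← conj l
    pure (and f g)

end LTL

/-! ## Weighted transition systems of activations -/

/-- A weighted transition system whose states are sets of activated links (or command nodes);
each state carries a number, and its observation is the set itself. -/
structure WTS (α W : Type) where
  states : List (ℕ × List α)
  start : List (ℕ × List α)
  trans : List ((ℕ × List α) × (ℕ × List α) × W)

section Planner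

variable {α W : Type} [DecidableEq α] [LinearOrder W] [AddCommMonoid W]

/-- The product transition system: the states are all subsets of `AP`, and there is exactly one
transition between every two of them, weighted by `cost`. -/
def transitionSystem (AP : List α) (start : Finset α → Bool) (cost : Finset α → Finset α → W) :
    Timed (WTS α W) := do
  let subsets ← sublists AP
  let states ← number 0 subsets
  let inits ← filter (fun q => do
    tick (q.2.length + 1)
    pure (start q.2.toFinset)) states
  let trans ← flatMap (fun q => map (fun q' => do
    tick (q.2.length + q'.2.length + 1)
    pure (q, q', cost q.2.toFinset q'.2.toFinset)) states) states
  pure ⟨states, inits, trans⟩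

/-! ## Translation of a formula into a Büchi automaton -/

/-- A truth labelling of the nodes of the syntax tree of a formula. The labellings that `elems`
lists play the role of the elementary sets of subformulas. -/
inductive Elem : Type
  | tt : Elem
  | atom : Bool → Elem
  | and : Elem → Elem → Bool → Elem
  | not : Elem → Bool → Elem
  | next : Elem → Bool → Elem
  | untl : Elem → Elem → Bool → Elem

/-- The label of the root. -/
def Elem.val : Elem → Bool
  | .tt => true
  | .atom v => v
  | .and _ _ v => v
  | .not _ v => v
  | .next _ v => v
  | .untl _ _ v => v

/-- All labellings of a formula in which the atoms are labelled according to the letter `A`, the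
boolean connectives are respected, and the labels of an until-formula and of its two parts are
locally consistent. -/
def elems (A : List α) : LTL α → Timed (List Elem)
  | .tt => do
    tick 1
    pure [.tt]
  | .atom a => do
    tick 1
    let v ← any (eqId a) A
    pure [.atom v]
  | .and f g => do
    tick 1
    let F ← elems A f
    let G ← elems A g
    flatMap (fun x => map (fun y => do
      tick 1
      pure (Elem.and x y (x.val && y.val))) G) F
  | .not f => do
    tick 1
    let F ← elems A f
    map (fun x => do
      tick 1
      pure (Elem.not x (!x.val))) F
  | .next f => do
    tick 1
    let F ← elems A f
    flatMap (fun x => do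
      tick 1
      pure [Elem.next x true, Elem.next x false]) F
  | .untl f g => do
    tick 1
    let F ← elems A f
    let G ← elems A g
    flatMap (fun x => flatMap (fun y => do
      tick 1
      pure (if y.val then [Elem.untl x y true]
        else if x.val then [Elem.untl x y true, Elem.untl x y false]
        else [Elem.untl x y false])) G) F

/-- May the second labelling (of the same formula) hold one time unit after the first? -/
def follows : Elem → Elem → Timed Bool
  | .tt, .tt => do
    tick 1
    pure true
  | .atom _, .atom _ => do
    tick 1
    pure true
  | .and x y _, .and x' y' _ => do
    tick 1
    let a ← follows x x'
    let b ← follows y y'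
    pure (a && b)
  | .not x _, .not x' _ => do
    tick 1
    follows x x'
  | .next x v, .next x' _ => do
    tick 1
    let a ← follows x x'
    pure (a && (v == x'.val))
  | .untl x y v, .untl x' y' v' => do
    tick 1
    let a ← follows x x'
    let b ← follows y y'
    pure (a && b && (v == (y.val || (x.val && v'))))
  | _, _ => do
    tick 1
    pure false

/-- For each until-subformula, whether the labelling belongs to its acceptance set: the
until-formula is false or its right-hand side is true. -/
def goals : Elem → Timed (List Bool)
  | .tt => do
    tick 1
    pure []
  | .atom _ => do
    tick 1
    pure []
  | .and x y _ => do
    tick 1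
    let a ← goals x
    let b ← goals y
    append a b
  | .not x _ => do
    tick 1
    goals x
  | .next x _ => do
    tick 1
    goals x
  | .untl x y v => do
    tick 1
    let a ← goals x
    let b ← goals y
    let m ← append a b
    pure ((y.val || !v) :: m)

/-- A nondeterministic Büchi automaton over the alphabet of subsets of `α`, given by tables; its
states are numbers, and `(s, A, s') ∈ delta` means `s' ∈ δ(s, A)`. -/
structure NBA (α : Type) where
  states : List ℕ
  start : List ℕ
  delta : List (ℕ × List α × ℕ)
  accept : List ℕ

/-- A state of the Büchi automaton of a formula: a letter, an elementary labelling for this letter,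
a counter that points to one of the acceptance sets, the number of these sets, and whether the
labelling lies in the set that the counter points to. -/
structure BuchiState (α : Type) where
  letter : List α
  label : Elem
  counter : ℕ
  size : ℕ
  good : Bool

/-- One copy of a labelling for every acceptance set. A formula without until-subformulas has the
set of all labellings as its only acceptance set. -/
def copies (A : List α) (B : Elem) : Timed (List (BuchiState α)) := do
  let bits ← goals B
  let bits' := if bits.isEmpty then [true] else bits
  let k ← length bits'
  let numbered ← number 0 bits'
  map (fun b => do
    tick 1
    pure ⟨A, B, b.1, k, b.2⟩) numbered

/-- The transition relation: the labellings follow each other, and the counter moves on when the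
acceptance set it points to is visited. -/
def moves (s t : BuchiState α) : Timed Bool := do
  let a ← follows s.label t.label
  tick 1
  pure (a && (t.counter == if s.good then (s.counter + 1) % s.size else s.counter))

/-- Translation of a formula over the atomic propositions `AP` into a Büchi automaton: the
generalized automaton on the elementary labellings, with the counter construction applied. -/
def buchi (AP : List α) (φ : LTL α) : Timed (NBA α) := do
  let letters ← sublists AP
  let raw ← flatMap (fun A => do
    let Bs ← elems A φ
    flatMap (copies A) Bs) letters
  let all ← number 0 raw
  let states ← map (fun s => do
    tick 1
    pure s.1) all
  let inits ← filter (fun s => do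
    tick 1
    pure (s.2.counter == 0 && s.2.label.val)) all
  let start ← map (fun s => do
    tick 1
    pure s.1) inits
  let delta ← flatMap (fun s => do
    let succs ← filter (fun t => moves s.2 t.2) all
    map (fun t => do
      tick 1
      pure (s.1, s.2.letter, t.1)) succs) all
  let finals ← filter (fun s => do
    tick 1
    pure (s.2.counter == 0 && s.2.good)) all
  let accept ← map (fun s => do
    tick 1
    pure s.1) finals
  pure ⟨states, start, delta, accept⟩

/-! ## The product automaton and the search for an optimal plan -/

/-- States of the product automaton: the number of a state of the transition system, and a state of
the Büchi automaton. -/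
abbrev Node := ℕ × ℕ

/-- The product of a weighted transition system and a Büchi automaton, a weighted directed graph
with initial and accepting nodes. -/
structure PBA (W : Type) where
  nodes : List Node
  start : List Node
  edges : List (Node × Node × W)
  accept : List Node

/-- All pairs of an entry of the first and an entry of the second list. -/
def pairs {β γ : Type} (k : List β) (l : List γ) : Timed (List (β × γ)) :=
  flatMap (fun a => map (fun b => do
    tick 1
    pure (a, b)) l) k

/-- The product automaton: `(q, s) → (q', s')` when `q → q'` and `s' ∈ δ(s, o(q))`. -/
def product (T : WTS α W) (B : NBA α) : Timed (PBA W) := do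
  let ids ← map (fun q => do
    tick 1
    pure q.1) T.states
  let nodes ← pairs ids B.states
  let initIds ← map (fun q => do
    tick 1
    pure q.1) T.start
  let start ← pairs initIds B.start
  let accept ← pairs ids B.accept
  let edges ← flatMap (fun e => do
    let ds ← filter (fun m => eqList eqId m.2.1 e.1.2) B.delta
    map (fun m => do
      tick 1
      pure ((e.1.1, m.1), (e.2.1.1, m.2.2), e.2.2)) ds) T.trans
  pure ⟨nodes, start, edges, accept⟩

/-- A table that holds for each node the cost of a walk to that node together with the walk, last
node first, if a walk is known. -/
abbrev Walks (W : Type) := List (Node × Option (W × List Node))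

def lookup (tbl : Walks W) (v : Node) : Timed (Option (W × List Node)) := do
  let row ← find (fun e => eqId e.1 v) tbl
  pure (row.bind Prod.snd)

def update (tbl : Walks W) (v : Node) (x : W × List Node) : Timed (Walks W) :=
  map (fun e => do
    let b ← eqId e.1 v
    pure (if b then (v, some x) else e)) tbl

/-- Use one edge of the graph to improve the walk to its target. -/
def relax (tbl : Walks W) (e : Node × Node × W) : Timed (Walks W) := do
  let a ← lookup tbl e.1
  match a with
  | none => pure tbl
  | some (du, pu) => do
    let b ← lookup tbl e.2.1
    match b with
    | none => do
      tick 1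
      update tbl e.2.1 (du + e.2.2, e.2.1 :: pu)
    | some (dv, _) => do
      tick 2
      if du + e.2.2 < dv then update tbl e.2.1 (du + e.2.2, e.2.1 :: pu) else pure tbl

/-- Cheapest walks from `src` to all nodes, by relaxing all edges as many times as there are
nodes. -/
def cheapest (P : PBA W) (src : Node) : Timed (Walks W) := do
  let tbl ← map (fun v => do
    let b ← eqId v src
    pure (v, if b then some (0, [src]) else none)) P.nodes
  foldl (fun t _ => foldl relax t P.edges) tbl P.nodes

/-- The cheapest walk from `u` to `v` according to the tables of all sources. -/
def walk (D : List (Node × Walks W)) (u v : Node) : Timed (Option (W × List Node)) := do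
  let row ← find (fun e => eqId e.1 u) D
  match row with
  | none => pure none
  | some e => lookup e.2 v

/-- The strongly connected component of `u`, represented by its first node in `nodes`. -/
def component (D : List (Node × Walks W)) (nodes : List Node) (u : Node) : Timed (Option Node) :=
  find (fun v => do
    let a ← walk D u v
    let b ← walk D v u
    pure (a.isSome && b.isSome)) nodes

/-- A lasso in the product automaton: its cost, its prefix and its suffix. -/
abbrev Lasso (W : Type) := W × List Node × List Node

/-- For every initial node `i`, every accepting node `f` and every edge `f → s` inside a strongly
connected component, the cheapest lasso that leads from `i` to `f` (the prefix) and then runs from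
`s` back to `f` again and again (the suffix). The cost is the sum of the costs of the transitions
inside the prefix and of those inside the suffix. -/
def lassos (P : PBA W) : Timed (List (Lasso W)) := do
  let D ← map (fun v => do
    let t ← cheapest P v
    pure (v, t)) P.nodes
  let inner ← filter (fun e => do
    let a ← component D P.nodes e.1
    let b ← component D P.nodes e.2.1
    tick 1
    pure (decide (a = b))) P.edges
  flatMap (fun f => do
    let out ← filter (fun e => eqId e.1 f) inner
    flatMap (fun i => do
      let p ← walk D i f
      match p with
      | none => pure []
      | some (w, pre) => do
        let pre' ← reverse pre
        flatMap (fun e => do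
          let s ← walk D e.2.1 f
          match s with
          | none => pure []
          | some (w', suf) => do
            let suf' ← reverse suf
            tick 1
            pure [(w + w', pre', suf')]) out) P.start) P.accept

/-- A lasso of least cost. -/
def best (l : List (Lasso W)) : Timed (Option (Lasso W)) :=
  foldl (fun b x => do
    tick 1
    match b with
    | none => pure (some x)
    | some y => pure (if x.1 < y.1 then some x else some y)) none l

/-- An infinite schedule `pre [suf]^ω` in prefix-suffix form. -/
structure Plan (α : Type) where
  pre : List (List α)
  suf : List (List α)

/-- The set that the schedule activates at time `t`. -/
def Plan.activeAt (p : Plan α) (t : ℕ) : List α :=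
  if t < p.pre.length then p.pre.getD t []
  else p.suf.getD ((t - p.pre.length) % p.suf.length) []

/-- Projection of a walk in the product automaton to the transition system. -/
def project (T : WTS α W) (walk : List Node) : Timed (List (List α)) :=
  map (fun v => do
    let q ← find (fun q => eqId q.1 v.1) T.states
    pure ((q.map Prod.snd).getD [])) walk

/-- Optimal temporal logic planning: build the transition system, translate the formula into a
Büchi automaton, form the product, search it for the cheapest accepting lasso, and project this
lasso to the transition system. -/
def plan (AP : List α) (φ : LTL α) (start : Finset α → Bool) (cost : Finset α → Finset α → W) :
    Timed (Option (Plan α)) := do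
  let T ← transitionSystem AP start cost
  let B ← buchi AP φ
  let P ← product T B
  let l ← lassos P
  let b ← best l
  match b with
  | none => pure none
  | some x => do
    let pre ← project T x.2.1
    let suf ← project T x.2.2
    pure (some ⟨pre, suf⟩)

end Planner

/-! ## The sensor network -/

/-- The network of sensors at the positions `x`: two of them are linked when they are at distance
at most `r`. -/
def sensorGraph {d N : ℕ} (x : Fin N → EuclideanSpace ℝ (Fin d)) (r : ℝ) :
    SimpleGraph (Fin N) where
  Adj i i' := i ≠ i' ∧ ‖x i - x i'‖ ≤ r
  symm := ⟨fun i i' h => ⟨h.1.symm, by rw [norm_sub_rev]; exact h.2⟩⟩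
  loopless := ⟨fun _ h => h.1 rfl⟩

/-- The command subgraph: the subgraph of the sensor network that is induced on the sensors at
distance at most `R` from the command node at `p`. -/
def commandSubgraph {d N : ℕ} (x : Fin N → EuclideanSpace ℝ (Fin d)) (r R : ℝ)
    (p : EuclideanSpace ℝ (Fin d)) : SimpleGraph {i : Fin N | ‖x i - p‖ ≤ R} :=
  (sensorGraph x r).induce {i : Fin N | ‖x i - p‖ ≤ R}

/-- The largest number of links in a command subgraph. -/
noncomputable def eMax {d N K : ℕ} (x : Fin N → EuclideanSpace ℝ (Fin d))
    (c : Fin K → EuclideanSpace ℝ (Fin d)) (r R : ℝ) : ℕ :=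
  Finset.univ.sup fun j => (commandSubgraph x r R (c j)).edgeSet.ncard

/-- A link between two sensors, named by its endpoints, the smaller one first. -/
abbrev Link (N : ℕ) := Fin N × Fin N

open Classical in
/-- The list of the links of a graph, the form in which the planners receive the network. -/
noncomputable def linkList {N : ℕ} (G : SimpleGraph (Fin N)) : List (Link N) :=
  ((List.finRange N).product (List.finRange N)).filter fun e => e.1 < e.2 ∧ G.Adj e.1 e.2

/-! ## The centralized planner -/

/-- Are the links different, and do they share an endpoint? -/
def interferes {N : ℕ} (e e' : Link N) : Timed Bool := do
  tick 6
  pure (decide (e' ≠ e ∧ (e'.1 = e.1 ∨ e'.1 = e.2 ∨ e'.2 = e.1 ∨ e'.2 = e.2)))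

/-- The specification of a list of links: whenever a link is active, the other links that share an
endpoint with it are not, and every link is active infinitely often. -/
def linkSpec {N : ℕ} (links : List (Link N)) : Timed (LTL (Link N)) := do
  let parts ← map (fun e => do
    let nbrs ← filter (interferes e) links
    let negs ← map (fun e' => do
      tick 1
      pure (LTL.not (LTL.atom e'))) nbrs
    let g ← LTL.conj negs
    pure (LTL.and (LTL.always (LTL.imp (LTL.atom e) g))
      (LTL.always (LTL.eventually (LTL.atom e))))) links
  LTL.conj parts

/-- The centralized planner, also run by each command node on its own subgraph. -/
noncomputable def centralized {N : ℕ} (links : List (Link N)) (start : Finset (Link N) → Bool)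
    (cost : Finset (Link N) → Finset (Link N) → ℝ≥0) : Timed (Option (Plan (Link N))) := do
  let φ ← linkSpec links
  plan links φ start cost

/-! ## The hierarchical planner -/

section Hierarchical

variable {d N K : ℕ}

open Classical in
/-- Are two points at distance at most `R`? -/
noncomputable def inRange (R : ℝ) (p q : EuclideanSpace ℝ (Fin d)) : Timed Bool := do
  tick (d + 1)
  pure (decide (‖p - q‖ ≤ R))

/-- The links of the command graph, in both directions: pairs of different command nodes whose
coverage regions of radius `R` overlap. -/
noncomputable def commandGraph (c : Fin K → EuclideanSpace ℝ (Fin d)) (R : ℝ) :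
    Timed (List (Fin K × Fin K)) := do
  let all ← pairs (List.finRange K) (List.finRange K)
  filter (fun e => do
    let b ← eqId e.1 e.2
    let v ← inRange (2 * R) (c e.1) (c e.2)
    pure (!b && v)) all

/-- The specification of the command nodes: whenever a command node is active, its neighbours are
not, and every command node is active infinitely often. -/
def commandSpec (cmd : List (Fin K × Fin K)) : Timed (LTL (Fin K)) := do
  let parts ← map (fun j => do
    let nbrs ← filter (fun e => eqId e.1 j) cmd
    let negs ← map (fun e => do
      tick 1
      pure (LTL.not (LTL.atom e.2))) nbrs
    let g ← LTL.conj negs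
    pure (LTL.and (LTL.always (LTL.imp (LTL.atom j) g))
      (LTL.always (LTL.eventually (LTL.atom j))))) (List.finRange K)
  LTL.conj parts

/-- A command node synthesizes an activation plan of the command nodes. Any feasible plan will do,
so that all transitions have cost `0`. -/
noncomputable def commandPlan (cmd : List (Fin K × Fin K)) (start : Finset (Fin K) → Bool) :
    Timed (Option (Plan (Fin K))) := do
  let ψ ← commandSpec cmd
  plan (List.finRange K) ψ start (fun _ _ => (0 : ℝ≥0))

/-- Comparison of two activation plans. -/
def eqPlan : Option (Plan (Fin K)) → Option (Plan (Fin K)) → Timed Bool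
  | none, none => do
    tick 1
    pure true
  | some p, some p' => do
    tick 1
    let a ← eqList (eqList eqId) p.pre p'.pre
    let b ← eqList (eqList eqId) p.suf p'.suf
    pure (a && b)
  | _, _ => do
    tick 1
    pure false

/-- Command node `j` checks its activation plan against those that its neighbours hold, and adopts
the plan of a neighbour in case of a discrepancy. -/
def consensus (cmd : List (Fin K × Fin K)) (j : Fin K) (ρ : Option (Plan (Fin K)))
    (held : List (Fin K × Option (Plan (Fin K)))) : Timed (Option (Plan (Fin K))) :=
  foldl (fun ρ' h => do
    let adj ← any (fun e => do
      let a ← eqId e.1 j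
      let b ← eqId e.2 h.1
      pure (a && b)) cmd
    if adj then do
      let same ← eqPlan ρ' h.2
      pure (if same then ρ' else h.2)
    else pure ρ') ρ held

/-- The links of the command subgraph of the command node at `p`. -/
noncomputable def localLinks (x : Fin N → EuclideanSpace ℝ (Fin d)) (R : ℝ)
    (p : EuclideanSpace ℝ (Fin d)) (links : List (Link N)) : Timed (List (Link N)) :=
  filter (fun e => do
    let a ← inRange R (x e.1) p
    let b ← inRange R (x e.2) p
    pure (a && b)) links

/-- What the hierarchical planner returns: for each command node, the activation plan it holds and
the plan for the links of its subgraph. -/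
abbrev HierarchicalPlan (N K : ℕ) :=
  List (Fin K × Option (Plan (Fin K)) × Option (Plan (Link N)))

/-- The global schedule that is returned: at time `t`, each command node `j` that is active
according to the activation plan activates the links that its own plan activates at time `t`. -/
def HierarchicalPlan.schedule (p : HierarchicalPlan N K) (t : ℕ) : Set (Link N) :=
  {e | ∃ j ρ τ, (j, some ρ, some τ) ∈ p ∧ j ∈ ρ.activeAt t ∧ e ∈ τ.activeAt t}

/-- The hierarchical planner. The input consists of the links and the positions of the sensors,
the positions of the command nodes, the range `R`, the sets of initial states, and the cost. -/
noncomputable def hierarchical (links : List (Link N)) (x : Fin N → EuclideanSpace ℝ (Fin d))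
    (c : Fin K → EuclideanSpace ℝ (Fin d)) (R : ℝ) (start : Finset (Link N) → Bool)
    (cmdStart : Finset (Fin K) → Bool) (cost : Finset (Link N) → Finset (Link N) → ℝ≥0) :
    Timed (HierarchicalPlan N K) := do
  let cmd ← commandGraph c R
  foldl (fun (out : HierarchicalPlan N K) j => do
    let ρ₀ ← commandPlan cmd cmdStart
    let held ← map (fun h => do
      tick 1
      pure (h.1, h.2.1)) out
    let ρ ← consensus cmd j ρ₀ held
    let own ← localLinks x R (c j) links
    let τ ← centralized own start cost
    tick 1
    pure ((j, ρ, τ) :: out)) [] (List.finRange K)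

end Hierarchical

end LNC

/-! Nothing about the correctness of the planner enters: a running time bound needs only the lengths
of the lists that are traversed and the cost of each visit. Every stage of `plan` is polynomial in
the size of its input tables, so the whole planner is polynomial in one number `S` that bounds `2 ^
AP.length`, the size of the formula and its `width`, a bound for the number of labellings per letter
(`plan_bounds`).

The exponential comes from `width`. Atoms are fixed by the letter and boolean connectives are
determined, so that only temporal operators leave a choice, a factor 2 each. The conjunct of one
link or command node contains exactly three until-operators, hence has width at most 8
(`LTL.width_activation_le`), and widths multiply in a conjunction. For `n` propositions all three
quantities are thus polynomial in `8 ^ n` (`LTL.conj_activation_bounds`), and a polynomial in `8 ^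
n` is `2 ^ O(n)` (`PolyBdd.apply_eight_pow_le`). With `n` the number of links this is the
centralized bound.

In the hierarchical planner, each of the `K` rounds plans for `K` command nodes and for at most
`eMax` links. Two further points are needed. The full list of links, which is scanned in every
round, has length at most `K * eMax`, because the margin `ε > r` puts each link into some command
subgraph (`length_linkList_le_mul_eMax`). The activation plans that are compared do not grow:
consensus only selects among plans that `commandPlan` produced (`isBounded_of_consensus_eq_some`).
The total is polynomial in `8 ^ (eMax + K)` (`hierarchical_bounds`). -/

namespace LNC

/-! ### Values and step counts of the list programs -/

namespace Timed

variable {β γ : Type}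

@[simp] theorem val_pure (b : β) : (pure b : Timed β).val = b := rfl

@[simp] theorem steps_pure (b : β) : (pure b : Timed β).steps = 0 := rfl

@[simp] theorem val_bind (m : Timed β) (f : β → Timed γ) : (m >>= f).val = (f m.val).val := rfl

@[simp] theorem steps_bind (m : Timed β) (f : β → Timed γ) :
    (m >>= f).steps = m.steps + (f m.val).steps := rfl

@[simp] theorem steps_tick (n : ℕ) : (tick n).steps = n := rfl

@[simp] theorem val_append (k l : List β) : (append k l).val = k ++ l := by
  induction k with
  | nil => simp [append]
  | cons a k ih => simp [append, ih]

@[simp] theorem steps_append (k l : List β) : (append k l).steps = k.length + 1 := by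
  induction k with
  | nil => simp [append]
  | cons a k ih => simp [append, ih]; omega

@[simp] theorem val_map (f : β → Timed γ) (l : List β) :
    (map f l).val = l.map fun a => (f a).val := by
  induction l with
  | nil => simp [map]
  | cons a k ih => simp [map, ih]

/-- One step per cell and one for the end of the list. The bound uses any `n` above the length, here
and in the lemmas below, so that nested bounds are closed expressions in the size parameters alone.
-/
theorem steps_map_le {f : β → Timed γ} {l : List β} {B n : ℕ} (hl : l.length ≤ n) (h : ∀ a ∈ l, (f a).steps ≤ B) :
    (map f l).steps ≤ n * (B + 1) + 1 := by
  suffices (map f l).steps ≤ l.length * (B + 1) + 1 from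
    this.trans (by gcongr)
  clear hl
  induction l with
  | nil => simp [map]
  | cons a k ih =>
    have h1 := h a (by simp)
    have h2 := ih fun b hb => h b (by simp [hb])
    simp only [map, steps_bind, steps_tick, steps_pure, List.length_cons]
    linarith

@[simp] theorem val_flatMap (f : β → Timed (List γ)) (l : List β) :
    (flatMap f l).val = l.flatMap fun a => (f a).val := by
  induction l with
  | nil => simp [flatMap]
  | cons a k ih => simp [flatMap, ih]

theorem length_flatMap_le {f : β → List γ} {l : List β} {c n : ℕ}
    (hl : l.length ≤ n) (h : ∀ a ∈ l, (f a).length ≤ c) : (l.flatMap f).length ≤ n * c := by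
  suffices (l.flatMap f).length ≤ l.length * c from
    this.trans (by gcongr)
  clear hl
  induction l with
  | nil => simp
  | cons a k ih =>
    have h1 := h a (by simp)
    have h2 := ih fun b hb => h b (by simp [hb])
    simp only [List.flatMap_cons, List.length_append, List.length_cons]
    linarith

/-- Besides `B`, an entry costs one step for its cell and up to `c + 1` for appending its result to
the rest. -/
theorem steps_flatMap_le {f : β → Timed (List γ)} {l : List β} {B c n : ℕ}
    (hl : l.length ≤ n) (h : ∀ a ∈ l, (f a).steps ≤ B) (hc : ∀ a ∈ l, (f a).val.length ≤ c) :
    (flatMap f l).steps ≤ n * (B + c + 2) + 1 := by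
  suffices (flatMap f l).steps ≤ l.length * (B + c + 2) + 1 from
    this.trans (by gcongr)
  clear hl
  induction l with
  | nil => simp [flatMap]
  | cons a k ih =>
    have h1 := h a (by simp)
    have h2 := hc a (by simp)
    have h3 := ih (fun b hb => h b (by simp [hb])) fun b hb => hc b (by simp [hb])
    simp only [flatMap, steps_bind, steps_tick, steps_append, List.length_cons]
    linarith

@[simp] theorem val_filter (p : β → Timed Bool) (l : List β) :
    (filter p l).val = l.filter fun a => (p a).val := by
  induction l with
  | nil => simp [filter]
  | cons a k ih => simp [filter, ih, List.filter_cons]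

theorem steps_filter_le {p : β → Timed Bool} {l : List β} {B n : ℕ}
    (hl : l.length ≤ n) (h : ∀ a ∈ l, (p a).steps ≤ B) : (filter p l).steps ≤ n * (B + 1) + 1 := by
  suffices (filter p l).steps ≤ l.length * (B + 1) + 1 from
    this.trans (by gcongr)
  clear hl
  induction l with
  | nil => simp [filter]
  | cons a k ih =>
    have h1 := h a (by simp)
    have h2 := ih fun b hb => h b (by simp [hb])
    simp only [filter, steps_bind, steps_tick, steps_pure, List.length_cons]
    linarith

@[simp] theorem val_find (p : β → Timed Bool) (l : List β) :
    (find p l).val = l.find? fun a => (p a).val := by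
  induction l with
  | nil => simp [find]
  | cons a k ih =>
    simp only [find, val_bind, List.find?_cons]
    cases (p a).val <;> simp [ih]

theorem steps_find_le {p : β → Timed Bool} {l : List β} {B n : ℕ}
    (hl : l.length ≤ n) (h : ∀ a ∈ l, (p a).steps ≤ B) : (find p l).steps ≤ n * (B + 1) + 1 := by
  suffices (find p l).steps ≤ l.length * (B + 1) + 1 from
    this.trans (by gcongr)
  clear hl
  induction l with
  | nil => simp [find]
  | cons a k ih =>
    have h1 := h a (by simp)
    have h2 := ih fun b hb => h b (by simp [hb])
    simp only [find, steps_bind, steps_tick, List.length_cons]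
    cases (p a).val
    · simp only [Bool.false_eq_true, if_false]
      linarith
    · simp only [if_true, steps_pure]
      linarith [Nat.zero_le (k.length * (B + 1))]

theorem steps_any_le {p : β → Timed Bool} {l : List β} {B n : ℕ} (hl : l.length ≤ n)
    (h : ∀ a ∈ l, (p a).steps ≤ B) : (any p l).steps ≤ n * (B + 1) + 1 :=
  steps_find_le hl h

/-- A loop with an invariant that may depend on the number of iterations so far. -/
theorem foldl_induction {f : γ → β → Timed γ} {l : List β} {P : ℕ → γ → Prop}
    (h : ∀ n c, P n c → ∀ a ∈ l, P (n + 1) (f c a).val) {n : ℕ} {c : γ} (hc : P n c) :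
    P (n + l.length) (foldl f c l).val := by
  induction l generalizing n c with
  | nil => simpa [foldl] using hc
  | cons a k ih =>
    simp only [foldl, val_bind, List.length_cons]
    have := ih (fun n c hc b hb => h n c hc b (by simp [hb])) (h n c hc a (by simp))
    rwa [Nat.add_assoc, Nat.add_comm 1] at this

/-- The cost of an iteration is controlled only for accumulators that satisfy the invariant at a
counter `m ≤ n`. This serves loops whose accumulator grows, such as that of `hierarchical`. -/
theorem steps_foldl_le_of_induction {f : γ → β → Timed γ} {l : List β} {P : ℕ → γ → Prop}
    {B n : ℕ} (hl : l.length ≤ n) (h : ∀ m c, P m c → ∀ a ∈ l, P (m + 1) (f c a).val)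
    (hB : ∀ m c, m ≤ n → P m c → ∀ a ∈ l, (f c a).steps ≤ B) {c : γ} (hc : P 0 c) :
    (foldl f c l).steps ≤ n * (B + 1) + 1 := by
  -- The induction starts at an arbitrary counter; the slack `m + l.length ≤ n` keeps the counter
  -- below `n` in all remaining iterations.
  suffices key : ∀ m, m + l.length ≤ n → ∀ c, P m c →
      (foldl f c l).steps ≤ l.length * (B + 1) + 1 from
    (key 0 (by omega) c hc).trans (by gcongr)
  clear hl hc c
  induction l with
  | nil => simp [foldl]
  | cons a k ih =>
    intro m hm c hc
    simp only [List.length_cons] at hm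
    have h1 := hB m c (by omega) hc a (by simp)
    have h2 := ih (fun m c hc b hb => h m c hc b (by simp [hb]))
      (fun m c hm hc b hb => hB m c hm hc b (by simp [hb])) (m + 1) (by omega) _
      (h m c hc a (by simp))
    simp only [foldl, steps_bind, steps_tick, List.length_cons]
    linarith

theorem steps_foldl_le {f : γ → β → Timed γ} {l : List β} {P : γ → Prop} {B n : ℕ}
    (hl : l.length ≤ n) (h : ∀ c, P c → ∀ a ∈ l, P (f c a).val)
    (hB : ∀ c, P c → ∀ a ∈ l, (f c a).steps ≤ B) {c : γ} (hc : P c) :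
    (foldl f c l).steps ≤ n * (B + 1) + 1 :=
  steps_foldl_le_of_induction (P := fun _ => P) hl (fun _ => h) (fun _ c _ => hB c) hc

theorem steps_foldl_le' {f : γ → β → Timed γ} {l : List β} {B n : ℕ} (hl : l.length ≤ n)
    (hB : ∀ c, ∀ a ∈ l, (f c a).steps ≤ B) (c : γ) :
    (foldl f c l).steps ≤ n * (B + 1) + 1 :=
  steps_foldl_le (P := fun _ => True) hl (fun _ _ _ _ => trivial) (fun c _ => hB c) trivial

theorem length_val_reverse (l : List β) : (reverse l).val.length = l.length := by
  have := foldl_induction (f := fun (m : List β) a => do tick 1; pure (a :: m)) (l := l)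
    (P := fun n m => m.length = n) (by intro n c hc a _; simp [hc]) (c := []) (n := 0) rfl
  simpa [reverse] using this

theorem steps_reverse_le {l : List β} {n : ℕ} (hl : l.length ≤ n) :
    (reverse l).steps ≤ n * 2 + 1 :=
  steps_foldl_le' hl (by simp) _

theorem steps_length_le {l : List β} {n : ℕ} (hl : l.length ≤ n) :
    (length l).steps ≤ n * 2 + 1 :=
  steps_foldl_le' hl (by simp) _

@[simp] theorem steps_number (n : ℕ) (l : List β) : (number n l).steps = l.length + 1 := by
  induction l generalizing n with
  | nil => simp [number]
  | cons a k ih => simp [number, ih]; omega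

@[simp] theorem length_val_number (n : ℕ) (l : List β) :
    (number n l).val.length = l.length := by
  induction l generalizing n with
  | nil => simp [number]
  | cons a k ih => simp [number, ih]

theorem mem_of_mem_number {n : ℕ} {l : List β} {b : ℕ × β} (h : b ∈ (number n l).val) :
    b.2 ∈ l := by
  induction l generalizing n with
  | nil => simp [number] at h
  | cons a k ih =>
    simp only [number, val_bind, val_pure, List.mem_cons] at h ⊢
    rcases h with rfl | h
    · exact .inl rfl
    · exact .inr (ih h)

@[simp] theorem length_val_sublists (l : List β) : (sublists l).val.length = 2 ^ l.length := by
  induction l with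
  | nil => simp [sublists]
  | cons a k ih => simp [sublists, ih]; ring

theorem length_le_of_mem_sublists {l k : List β} (h : k ∈ (sublists l).val) :
    k.length ≤ l.length := by
  induction l generalizing k with
  | nil => simp_all [sublists]
  | cons a l ih =>
    simp only [sublists, val_bind, val_pure, val_append, val_map, List.mem_append,
      List.mem_map] at h
    rcases h with ⟨m, hm, rfl⟩ | h
    · simpa using ih hm
    · exact (ih h).trans (by simp)

/-- A new element on top of `k` others costs at most `3 * 2 ^ k + 3 ≤ 6 * 2 ^ k` steps for the map
and the append, which is exactly the increment of `6 * 2 ^ k`. -/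
theorem steps_sublists_le (l : List β) : (sublists l).steps ≤ 6 * 2 ^ l.length := by
  induction l with
  | nil => simp [sublists]
  | cons a k ih =>
    have h1 := steps_map_le (f := fun m : List β => do tick 1; pure (a :: m))
      (length_val_sublists k).le (B := 1) (by simp)
    simp only [sublists, steps_bind, steps_tick, steps_append, val_map, List.length_map,
      length_val_sublists, List.length_cons, pow_succ]
    have := Nat.one_le_two_pow (n := k.length)
    omega

@[simp] theorem steps_eqId [DecidableEq β] (a b : β) : (eqId a b).steps = 1 := rfl

@[simp] theorem val_eqId [DecidableEq β] (a b : β) : (eqId a b).val = decide (a = b) := rfl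

/-- The comparison stops at the end of the shorter list, so a bound on one of the two lists
suffices. Later uses know a bound for the second list only. -/
theorem steps_eqList_le {eq : β → β → Timed Bool} {k l : List β} {B n : ℕ}
    (hl : l.length ≤ n) (h : ∀ a, ∀ b ∈ l, (eq a b).steps ≤ B) : (eqList eq k l).steps ≤ n * (B + 1) + 1 := by
  suffices (eqList eq k l).steps ≤ l.length * (B + 1) + 1 from
    this.trans (by gcongr)
  clear hl
  induction l generalizing k with
  | nil => cases k <;> simp [eqList]
  | cons b l ih =>
    cases k with
    | nil => simp [eqList]
    | cons a k =>
      have h1 := h a b (by simp)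
      have h2 := ih (k := k) fun a b hb => h a b (by simp [hb])
      simp only [eqList, steps_bind, steps_tick, List.length_cons]
      cases (eq a b).val
      · simp only [Bool.false_eq_true, if_false, steps_pure]
        linarith [Nat.zero_le (l.length * (B + 1))]
      · simp only [if_true]
        linarith

end Timed

/-! ### Polynomially bounded functions -/

/-- A function on the natural numbers that is bounded by a polynomial. -/
@[fun_prop]
def PolyBdd (f : ℕ → ℕ) : Prop := ∃ C k : ℕ, ∀ n, f n ≤ C * (n + 1) ^ k

namespace PolyBdd

variable {f g : ℕ → ℕ}

@[fun_prop]
theorem id' : PolyBdd fun n => n := ⟨1, 1, fun n => by simp⟩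

@[fun_prop]
theorem const (c : ℕ) : PolyBdd fun _ => c := ⟨c, 0, fun n => by simp⟩

@[fun_prop]
theorem add (hf : PolyBdd f) (hg : PolyBdd g) : PolyBdd fun n => f n + g n := by
  obtain ⟨C, k, hf⟩ := hf
  obtain ⟨D, l, hg⟩ := hg
  refine ⟨C + D, k + l, fun n => (Nat.add_le_add (hf n) (hg n)).trans ?_⟩
  rw [add_mul]
  gcongr <;> omega

@[fun_prop]
theorem mul (hf : PolyBdd f) (hg : PolyBdd g) : PolyBdd fun n => f n * g n := by
  obtain ⟨C, k, hf⟩ := hf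
  obtain ⟨D, l, hg⟩ := hg
  refine ⟨C * D, k + l, fun n => (Nat.mul_le_mul (hf n) (hg n)).trans ?_⟩
  rw [pow_add]
  exact le_of_eq (by ring)

@[fun_prop]
theorem pow (hf : PolyBdd f) (m : ℕ) : PolyBdd fun n => f n ^ m := by
  induction m with
  | zero => simpa using const 1
  | succ m ih => simpa only [pow_succ] using ih.mul hf

@[fun_prop]
theorem comp (hf : PolyBdd f) (hg : PolyBdd g) : PolyBdd fun n => f (g n) := by
  obtain ⟨C, k, hf⟩ := hf
  have h : PolyBdd fun n => C * (g n + 1) ^ k := (const C).mul ((hg.add (const 1)).pow k)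
  obtain ⟨D, l, h⟩ := h
  exact ⟨D, l, fun n => (hf (g n)).trans (h n)⟩

/-- The bounding polynomial is itself monotone. This allows bounds at `8 ^ K` and `8 ^ n` to be
compared at the common argument `8 ^ (n + K)`. -/
theorem exists_monotone (hf : PolyBdd f) : ∃ g, PolyBdd g ∧ Monotone g ∧ ∀ n, f n ≤ g n := by
  obtain ⟨C, k, hf⟩ := hf
  refine ⟨fun n => C * (n + 1) ^ k, ⟨C, k, fun n => le_rfl⟩, fun m n h => ?_, hf⟩
  dsimp only
  gcongr

/-- A polynomial of degree `k` at `8 ^ n = 2 ^ (3 * n)` has order `2 ^ (3 * k * n)`; replacing `8 ^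
n + 1` by `2 * 8 ^ n` costs the factor `2 ^ k`. -/
theorem apply_eight_pow_le (hf : PolyBdd f) : ∃ C a : ℕ, ∀ n, f (8 ^ n) ≤ C * 2 ^ (a * n) := by
  obtain ⟨C, k, hf⟩ := hf
  refine ⟨C * 2 ^ k, 3 * k, fun n => (hf _).trans ?_⟩
  have h : 8 ^ n + 1 ≤ 2 * 8 ^ n := by
    have := Nat.one_le_pow n 8 (by norm_num)
    omega
  calc C * (8 ^ n + 1) ^ k ≤ C * (2 * 8 ^ n) ^ k := by gcongr
    _ = C * 2 ^ k * 2 ^ (3 * k * n) := by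
      rw [mul_pow, mul_assoc, show (8 : ℕ) = 2 ^ 3 by norm_num, ← pow_mul, ← pow_mul]
      ring_nf

end PolyBdd

open Timed

/-! ### Formulas and their elementary labellings -/

namespace LTL

variable {α : Type}

/-- The number of nodes of a formula. -/
def size : LTL α → ℕ
  | tt => 1
  | atom _ => 1
  | and f g => size f + size g + 1
  | not f => size f + 1
  | next f => size f + 1
  | untl f g => size f + size g + 1

/-- A bound for the number of labellings of a formula for a given letter. -/
def width : LTL α → ℕ
  | tt => 1
  | atom _ => 1
  | and f g => width f * width g
  | not f => width f
  | next f => 2 * width f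
  | untl f g => 2 * (width f * width g)

theorem one_le_width (φ : LTL α) : 1 ≤ width φ := by
  induction φ <;> simp only [width, le_refl] <;> first | assumption | skip
  · exact Nat.mul_pos ‹_› ‹_›
  · omega
  · exact Nat.mul_pos two_pos (Nat.mul_pos ‹_› ‹_›)

end LTL

/-- The number of nodes of a labelling. -/
def Elem.size : Elem → ℕ
  | .tt => 1
  | .atom _ => 1
  | .and x y _ => size x + size y + 1
  | .not x _ => size x + 1
  | .next x _ => size x + 1
  | .untl x y _ => size x + size y + 1

theorem steps_follows_le (x y : Elem) : (follows x y).steps ≤ x.size := by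
  induction x generalizing y with
  | tt => cases y <;> simp [follows, Elem.size]
  | atom => cases y <;> simp [follows, Elem.size]
  | and a b v iha ihb =>
    cases y <;> simp [follows, Elem.size]
    rename_i a' b' _
    have := iha a'; have := ihb b'; omega
  | not a v ih =>
    cases y <;> simp [follows, Elem.size]
    rename_i a' _
    have := ih a'; omega
  | next a v ih =>
    cases y <;> simp [follows, Elem.size]
    rename_i a' _
    have := ih a'; omega
  | untl a b v iha ihb =>
    cases y <;> simp [follows, Elem.size]
    rename_i a' b' _
    have := iha a'; have := ihb b'; omega

theorem length_goals_le (x : Elem) : (goals x).val.length ≤ x.size := by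
  induction x <;> simp [goals, Elem.size] <;> omega

/-- Quadratic rather than linear, since each binary node appends the list of its left subtree. -/
theorem steps_goals_le (x : Elem) : (goals x).steps ≤ 2 * x.size ^ 2 := by
  induction x with
  | tt => simp [goals, Elem.size]
  | atom => simp [goals, Elem.size]
  | and a b v iha ihb =>
    have := length_goals_le a
    simp only [goals, Elem.size, steps_bind, steps_tick, steps_append]
    nlinarith [Nat.zero_le (a.size * b.size), Nat.zero_le a.size, Nat.zero_le b.size]
  | not a v ih =>
    simp only [goals, Elem.size, steps_bind, steps_tick]
    nlinarith [Nat.zero_le a.size]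
  | next a v ih =>
    simp only [goals, Elem.size, steps_bind, steps_tick]
    nlinarith [Nat.zero_le a.size]
  | untl a b v iha ihb =>
    have := length_goals_le a
    simp only [goals, Elem.size, steps_bind, steps_tick, steps_append, steps_pure]
    nlinarith [Nat.zero_le (a.size * b.size), Nat.zero_le a.size, Nat.zero_le b.size]

section Elems

variable {α : Type} [DecidableEq α]

theorem size_of_mem_elems {A : List α} {φ : LTL α} {x : Elem} (h : x ∈ (elems A φ).val) :
    x.size = φ.size := by
  induction φ generalizing x with
  | tt => simp_all [elems, Elem.size, LTL.size]
  | atom => simp_all [elems, Elem.size, LTL.size]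
  | and f g ihf ihg =>
    simp only [elems, val_bind, val_flatMap, val_map, val_pure, List.mem_flatMap,
      List.mem_map] at h
    obtain ⟨y, hy, z, hz, rfl⟩ := h
    simp [Elem.size, LTL.size, ihf hy, ihg hz]
  | not f ih =>
    simp only [elems, val_bind, val_map, val_pure, List.mem_map] at h
    obtain ⟨y, hy, rfl⟩ := h
    simp [Elem.size, LTL.size, ih hy]
  | next f ih =>
    simp only [elems, val_bind, val_flatMap, val_pure, List.mem_flatMap] at h
    obtain ⟨y, hy, h⟩ := h
    have := ih hy
    simp only [List.mem_cons, List.not_mem_nil, or_false] at h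
    rcases h with rfl | rfl <;> simp [Elem.size, LTL.size, this]
  | untl f g ihf ihg =>
    simp only [elems, val_bind, val_flatMap, val_pure, List.mem_flatMap] at h
    obtain ⟨y, hy, z, hz, h⟩ := h
    have h1 := ihf hy
    have h2 := ihg hz
    split_ifs at h <;> simp only [List.mem_cons, List.not_mem_nil, or_false] at h <;>
      first
      | (subst h; simp [Elem.size, LTL.size, h1, h2])
      | (rcases h with rfl | rfl <;> simp [Elem.size, LTL.size, h1, h2])

/-- Each pair of labellings of the parts extends in one way through a conjunction and in at most two
through an until, independently of the letter. -/
theorem length_elems_le (A : List α) (φ : LTL α) : (elems A φ).val.length ≤ φ.width := by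
  induction φ with
  | tt => simp [elems, LTL.width]
  | atom => simp [elems, LTL.width]
  | and f g ihf ihg =>
    simp only [elems, val_bind, val_flatMap, val_map, val_pure, LTL.width]
    exact length_flatMap_le ihf fun x _ => (List.length_map ..).le.trans ihg
  | not f ih => simpa [elems, LTL.width] using ih
  | next f ih =>
    simp only [elems, val_bind, val_flatMap, val_pure, LTL.width]
    exact (length_flatMap_le ih (c := 2) (by simp)).trans (by omega)
  | untl f g ihf ihg =>
    simp only [elems, val_bind, val_flatMap, val_pure, LTL.width]
    refine (length_flatMap_le ihf fun x _ => length_flatMap_le ihg (c := 2) fun y _ => ?_).trans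
      (by linarith)
    split_ifs <;> simp

/-- Every node is charged the same amount, with the width of the whole formula: widths are at least
1, so that the width of a part never exceeds that of the whole. The term `2 * A.length` pays for
looking up an atom in the letter, and 12 leaves room for the list operations at any connective. -/
theorem steps_elems_le (A : List α) (φ : LTL α) :
    (elems A φ).steps ≤ φ.size * ((2 * A.length + 12) * φ.width) := by
  induction φ with
  | tt => simp [elems, LTL.width, LTL.size]
  | atom a =>
    have := steps_any_le (p := eqId a) (le_refl A.length) (B := 1) (by simp)
    simp only [elems, LTL.width, LTL.size, steps_bind, steps_tick, steps_pure]
    omega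
  | and f g ihf ihg =>
    simp only [elems, LTL.width, LTL.size, steps_bind, steps_tick]
    have hf := length_elems_le A f
    have hg := length_elems_le A g
    have h := steps_flatMap_le hf (B := g.width * 2 + 1) (c := g.width)
      (f := fun x => map (fun y => do
      tick 1
      pure (Elem.and x y (x.val && y.val))) (elems A g).val)
      (fun x _ => (steps_map_le hg (B := 1) (by simp)))
      (fun x _ => by simpa using hg)
    have h1 := f.one_le_width
    have h2 := g.one_le_width
    have h3 : f.width ≤ f.width * g.width := Nat.le_mul_of_pos_right _ h2
    have h4 : g.width ≤ f.width * g.width := Nat.le_mul_of_pos_left _ h1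
    have h6 := Nat.mul_le_mul_left f.size (Nat.mul_le_mul_left (2 * A.length + 12) h3)
    have h7 := Nat.mul_le_mul_left g.size (Nat.mul_le_mul_left (2 * A.length + 12) h4)
    have h8 := Nat.zero_le (A.length * (f.width * g.width))
    linarith
  | not f ih =>
    simp only [elems, LTL.width, LTL.size, steps_bind, steps_tick]
    have hf := length_elems_le A f
    have h := steps_map_le hf (B := 1) (f := fun x => do
      tick 1
      pure (Elem.not x (!x.val))) (by simp)
    have h1 := f.one_le_width
    have h8 := Nat.zero_le (A.length * f.width)
    linarith
  | next f ih =>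
    simp only [elems, LTL.width, LTL.size, steps_bind, steps_tick]
    have hf := length_elems_le A f
    have h := steps_flatMap_le hf (B := 1) (c := 2) (f := fun x => do
      tick 1
      pure [Elem.next x true, Elem.next x false]) (by simp) (by simp)
    have h1 := f.one_le_width
    have h8 := Nat.zero_le (A.length * f.width)
    have h9 := Nat.zero_le (f.size * ((2 * A.length + 12) * f.width))
    linarith
  | untl f g ihf ihg =>
    simp only [elems, LTL.width, LTL.size, steps_bind, steps_tick]
    have hf := length_elems_le A f
    have hg := length_elems_le A g
    have h := steps_flatMap_le hf (B := g.width * 5 + 1) (c := g.width * 2)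
      (f := fun x => flatMap (fun y => do
      tick 1
      pure (if y.val then [Elem.untl x y true]
        else if x.val then [Elem.untl x y true, Elem.untl x y false]
        else [Elem.untl x y false])) (elems A g).val)
      (fun x _ => (steps_flatMap_le hg (B := 1) (c := 2) (by simp)
        (fun y _ => by simp only [val_bind, val_pure]; split_ifs <;> simp)))
      (fun x _ => by
        simp only [val_flatMap, val_bind, val_pure]
        refine length_flatMap_le hg (c := 2) fun y _ => ?_
        split_ifs <;> simp)
    have h1 := f.one_le_width
    have h2 := g.one_le_width
    have h3 : f.width ≤ f.width * g.width := Nat.le_mul_of_pos_right _ h2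
    have h4 : g.width ≤ f.width * g.width := Nat.le_mul_of_pos_left _ h1
    have h6 := Nat.mul_le_mul_left f.size (Nat.mul_le_mul_left (2 * A.length + 12) h3)
    have h7 := Nat.mul_le_mul_left g.size (Nat.mul_le_mul_left (2 * A.length + 12) h4)
    have h8 := Nat.zero_le (A.length * (f.width * g.width))
    have h9 := Nat.zero_le (f.size * ((2 * A.length + 12) * (f.width * g.width)))
    have h10 := Nat.zero_le (g.size * ((2 * A.length + 12) * (f.width * g.width)))
    linarith

end Elems

/-! ### The Büchi automaton -/

section Buchi

variable {α : Type}

/-- The extra 1 covers the default acceptance set of a formula without until-subformulas. -/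
theorem length_copies_le (A : List α) (B : Elem) : (copies A B).val.length ≤ B.size + 1 := by
  have := length_goals_le B
  simp only [copies, val_bind, val_map, List.length_map, length_val_number]
  split_ifs
  · simp
  · omega

theorem steps_copies_le (A : List α) (B : Elem) :
    (copies A B).steps ≤ 2 * B.size ^ 2 + 5 * (B.size + 1) + 3 := by
  have h2 := steps_goals_le B
  simp only [copies, steps_bind, steps_number]
  set l := if (goals B).val.isEmpty then [true] else (goals B).val with hl
  have h3 : l.length ≤ B.size + 1 := by
    have := length_goals_le B
    rw [hl]
    split_ifs
    · simp
    · omega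
  have h4 := steps_length_le h3
  have h5 := steps_map_le ((length_val_number 0 l).le.trans h3) (B := 1) (f := fun b => do
    tick 1
    pure (⟨A, B, b.1, (Timed.length l).val, b.2⟩ : BuchiState α)) (by simp)
  linarith

theorem label_of_mem_copies {A : List α} {B : Elem} {s : BuchiState α}
    (h : s ∈ (copies A B).val) : s.label = B := by
  simp only [copies, val_bind, val_map, val_pure, List.mem_map] at h
  obtain ⟨b, -, rfl⟩ := h
  rfl

theorem steps_moves_le (s t : BuchiState α) : (moves s t).steps ≤ s.label.size + 1 := by
  have := steps_follows_le s.label t.label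
  simp only [moves, steps_bind, steps_tick, steps_pure]
  omega

/-- A bound for the number of states of the Büchi automaton of a formula. -/
def buchiSize (S : ℕ) : ℕ := S * (S * (S + 1))

@[fun_prop]
theorem polyBdd_buchiSize : PolyBdd buchiSize := by
  unfold buchiSize
  fun_prop

/-- The lists of an automaton have the lengths that are expected when it has `n` states. -/
structure NBA.IsBounded (B : NBA α) (n : ℕ) : Prop where
  states : B.states.length ≤ n
  start : B.start.length ≤ n
  accept : B.accept.length ≤ n
  delta : B.delta.length ≤ n * n

/-- There are at most `S` letters, `S` labellings for each and `S + 1` copies of each labelling,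
which is `buchiSize S`. The polynomial lists the costs of the successive stages of `buchi`. -/
theorem buchi_bounds : ∃ p, PolyBdd p ∧ ∀ {α : Type} [DecidableEq α] (AP : List α) (φ : LTL α)
    (S : ℕ), 2 ^ AP.length ≤ S → φ.size ≤ S → φ.width ≤ S →
      (buchi AP φ).steps ≤ p S ∧ (buchi AP φ).val.IsBounded (buchiSize S) := by
  refine ⟨fun S => 6 * S + (S * (S * ((2 * S + 12) * S) +
      (S * (2 * S ^ 2 + 5 * (S + 1) + 3 + (S + 1) + 2) + 1) + S * (S + 1) + 2) + 1) +
      (buchiSize S + 1) + 4 * (buchiSize S * 2 + 1) +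
      (buchiSize S * ((buchiSize S * (S + 2) + 1) + (buchiSize S * 2 + 1) + buchiSize S + 2) + 1) +
      (buchiSize S * 2 + 1), by fun_prop, ?_⟩
  intro α _ AP φ S hS hφ hw
  have hletters := (length_val_sublists AP).le.trans hS
  have hcopies (A : List α) : ((elems A φ).val.flatMap fun B => (copies A B).val).length ≤
      S * (S + 1) :=
    length_flatMap_le ((length_elems_le A φ).trans hw) fun B hB =>
      (length_copies_le A B).trans (by rw [size_of_mem_elems hB]; omega)
  have h1 := (steps_sublists_le AP).trans (Nat.mul_le_mul_left 6 hS)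
  have h2 := steps_flatMap_le (f := fun A => do
    let Bs ← elems A φ
    flatMap (copies A) Bs) (B := S * ((2 * S + 12) * S) +
      (S * (2 * S ^ 2 + 5 * (S + 1) + 3 + (S + 1) + 2) + 1)) (c := S * (S + 1)) hletters
    (fun A hA => by
      -- A letter has at most `AP.length` entries, and `AP.length < 2 ^ AP.length ≤ S`, so `S`
      -- bounds the letters without a further hypothesis.
      have hA : A.length ≤ S :=
        (length_le_of_mem_sublists hA).trans (Nat.lt_two_pow_self.le.trans hS)
      refine Nat.add_le_add ((steps_elems_le A φ).trans (by gcongr)) (steps_flatMap_le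
        ((length_elems_le A φ).trans hw) (fun B hB => ?_) fun B hB => ?_)
      · refine (steps_copies_le A B).trans ?_
        rw [size_of_mem_elems hB]
        gcongr
      · refine (length_copies_le A B).trans ?_
        rw [size_of_mem_elems hB]
        gcongr)
    (fun A _ => by simpa using hcopies A)
  have hraw : ((sublists AP).val.flatMap fun A =>
      (elems A φ).val.flatMap fun B => (copies A B).val).length ≤ buchiSize S :=
    length_flatMap_le hletters fun A _ => hcopies A
  have hlabel : ∀ s ∈ ((sublists AP).val.flatMap fun A =>
      (elems A φ).val.flatMap fun B => (copies A B).val), s.label.size ≤ S := by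
    intro s hs
    simp only [List.mem_flatMap] at hs
    obtain ⟨A, -, B, hB, hs⟩ := hs
    rw [label_of_mem_copies hs, size_of_mem_elems hB]
    exact hφ
  simp only [buchi, steps_bind, val_bind, val_flatMap, steps_number, val_map, val_filter,
    steps_pure, val_pure] at h2 ⊢
  generalize hr : ((sublists AP).val.flatMap fun A =>
      (elems A φ).val.flatMap fun B => (copies A B).val) = raw at *
  have hall : (number 0 raw).val.length ≤ buchiSize S := by simpa using hraw
  have hsub (p : ℕ × BuchiState α → Bool) : ((number 0 raw).val.filter p).length ≤ buchiSize S :=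
    (List.length_filter_le _ _).trans hall
  constructor
  · have h3 := steps_map_le (f := fun s : ℕ × BuchiState α => do tick 1; pure s.1) (B := 1) hall
      (by simp)
    have h4 := steps_filter_le (p := fun s : ℕ × BuchiState α => do
      tick 1
      pure (s.2.counter == 0 && s.2.label.val)) (B := 1) hall (by simp)
    have h5 := steps_map_le (f := fun s : ℕ × BuchiState α => do tick 1; pure s.1) (B := 1)
      (hsub fun s => s.2.counter == 0 && s.2.label.val) (by simp)
    have h6 := steps_flatMap_le (f := fun s : ℕ × BuchiState α => do
      let succs ← filter (fun t => moves s.2 t.2) (number 0 raw).val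
      map (fun t => do
        tick 1
        pure (s.1, s.2.letter, t.1)) succs)
      (B := (buchiSize S * (S + 2) + 1) + (buchiSize S * 2 + 1)) (c := buchiSize S) hall
      (fun s hs => Nat.add_le_add (steps_filter_le hall fun t _ => (steps_moves_le _ _).trans
        (Nat.succ_le_succ (hlabel _ (mem_of_mem_number hs))))
        (steps_map_le (by simpa using hsub _) (by simp)))
      (fun s _ => by simpa using hsub _)
    have h7 := steps_filter_le (p := fun s : ℕ × BuchiState α => do
      tick 1
      pure (s.2.counter == 0 && s.2.good)) (B := 1) hall (by simp)
    have h8 := steps_map_le (f := fun s : ℕ × BuchiState α => do tick 1; pure s.1) (B := 1)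
      (hsub fun s => s.2.counter == 0 && s.2.good) (by simp)
    linarith
  · refine ⟨?_, ?_, ?_, ?_⟩
    · simpa using hraw
    · simpa using hsub _
    · simpa using hsub _
    · exact length_flatMap_le hall fun s _ => by simpa using hsub _

end Buchi

/-! ### The transition system and the product automaton -/

section Product

variable {α W : Type} [DecidableEq α] [LinearOrder W] [AddCommMonoid W]

/-- All lists of a transition system have the lengths that are expected when it has `S` states,
which are sets of at most `S` elements. -/
structure WTS.IsBounded (T : WTS α W) (S : ℕ) : Prop where
  states : T.states.length ≤ S
  start : T.start.length ≤ S
  trans : T.trans.length ≤ S * S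
  length_state : ∀ q ∈ T.states, q.2.length ≤ S
  length_source : ∀ e ∈ T.trans, e.1.2.length ≤ S

theorem transitionSystem_bounds : ∃ p, PolyBdd p ∧
    ∀ {α W : Type} [DecidableEq α] (AP : List α) (start : Finset α → Bool)
      (cost : Finset α → Finset α → W) (S : ℕ), 2 ^ AP.length ≤ S →
      (transitionSystem AP start cost).steps ≤ p S ∧
        (transitionSystem AP start cost).val.IsBounded S := by
  refine ⟨fun S => 6 * S + (S + 1) + (S * (S + 1 + 1) + 1) +
    (S * ((S * (S + S + 1 + 1) + 1) + S + 2) + 1), by fun_prop, ?_⟩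
  intro α W _ AP start cost S hS
  have hlen : (sublists AP).val.length ≤ S := (length_val_sublists AP).le.trans hS
  have hstates : (number 0 (sublists AP).val).val.length ≤ S := by simpa using hS
  have hstate : ∀ q ∈ (number 0 (sublists AP).val).val, q.2.length ≤ S := fun q hq =>
    (length_le_of_mem_sublists (mem_of_mem_number hq)).trans (Nat.lt_two_pow_self.le.trans hS)
  constructor
  · have h1 := (steps_sublists_le AP).trans (Nat.mul_le_mul_left 6 hS)
    have h2 := steps_filter_le (p := fun q : ℕ × List α => do
      tick (q.2.length + 1)
      pure (start q.2.toFinset)) (B := S + 1) hstates (by simpa using hstate)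
    have h3 := steps_flatMap_le (f := fun q : ℕ × List α => map (fun q' : ℕ × List α => do
      tick (q.2.length + q'.2.length + 1)
      pure (q, q', cost q.2.toFinset q'.2.toFinset)) (number 0 (sublists AP).val).val)
      (B := S * (S + S + 1 + 1) + 1) (c := S) hstates
      (fun q hq => steps_map_le hstates fun q' hq' => by
        have := hstate q hq
        have := hstate q' hq'
        simp only [steps_bind, steps_tick, steps_pure]
        omega)
      (fun q _ => by simpa using hS)
    simp only [transitionSystem, steps_bind, steps_number, steps_pure]
    linarith
  · refine ⟨hstates, ?_, ?_, hstate, ?_⟩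
    · simpa [transitionSystem] using (List.length_filter_le _ _).trans hstates
    · simp only [transitionSystem, val_bind, val_flatMap, val_map, val_pure]
      exact length_flatMap_le hstates fun q _ => by simpa using hS
    · simp only [transitionSystem, val_bind, val_flatMap, val_map, val_pure, List.mem_flatMap,
        List.mem_map]
      rintro _ ⟨q, hq, q', -, rfl⟩
      exact hstate q hq

/-- All lists of a product automaton have length at most `G`. -/
structure PBA.IsBounded (P : PBA W) (G : ℕ) : Prop where
  nodes : P.nodes.length ≤ G
  start : P.start.length ≤ G
  accept : P.accept.length ≤ G
  edges : P.edges.length ≤ G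

theorem length_pairs_le {β γ : Type} {k : List β} {l : List γ} {m n : ℕ} (hk : k.length ≤ m)
    (hl : l.length ≤ n) : (pairs k l).val.length ≤ m * n := by
  simp only [pairs, val_flatMap, val_map]
  exact length_flatMap_le hk fun _ _ => by simpa using hl

theorem steps_pairs_le {β γ : Type} {k : List β} {l : List γ} {m n : ℕ} (hk : k.length ≤ m)
    (hl : l.length ≤ n) : (pairs k l).steps ≤ m * ((n * 2 + 1) + n + 2) + 1 :=
  steps_flatMap_le hk (fun _ _ => steps_map_le hl (by simp)) fun _ _ => by simpa using hl

/-- A bound for the size of the product automaton. -/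
def productSize (S n : ℕ) : ℕ := S * n + S * S * (n * n)

/-- The two size parameters stay separate here; the condition on `p` replaces a notion of polynomial
in two variables. In `productSize`, one summand counts pairs of states and the other pairs of a
transition with an entry of `delta`, so that their sum bounds all four lists. -/
theorem product_bounds : ∃ p : ℕ → ℕ → ℕ, (∀ q, PolyBdd q → PolyBdd fun S => p S (q S)) ∧
    ∀ {α W : Type} [DecidableEq α] (T : WTS α W) (B : NBA α) (S n : ℕ), T.IsBounded S →
      B.IsBounded n → (product T B).steps ≤ p S n ∧
        (product T B).val.IsBounded (productSize S n) := by
  refine ⟨fun S n => 2 * (S * 2 + 1) + 3 * (S * ((n * 2 + 1) + n + 2) + 1) +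
    (S * S * ((n * n * ((S * 2 + 1) + 1) + 1) + (n * n * 2 + 1) + n * n + 2) + 1),
    fun q hq => by fun_prop, ?_⟩
  intro α W _ T B S n hT hB
  have hids : (T.states.map fun q => q.1).length ≤ S := by simpa using hT.states
  have hinits : (T.start.map fun q => q.1).length ≤ S := by simpa using hT.start
  have hds (e : (ℕ × List α) × (ℕ × List α) × W) :
      (B.delta.filter fun m => (eqList eqId m.2.1 e.1.2).val).length ≤ n * n :=
    (List.length_filter_le _ _).trans hB.delta
  constructor
  · have h1 := steps_map_le (f := fun q : ℕ × List α => do tick 1; pure q.1) (B := 1) hT.states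
      (by simp)
    have h2 := steps_map_le (f := fun q : ℕ × List α => do tick 1; pure q.1) (B := 1) hT.start
      (by simp)
    have h3 := steps_pairs_le hids hB.states
    have h4 := steps_pairs_le hinits hB.start
    have h5 := steps_pairs_le hids hB.accept
    have h6 := steps_flatMap_le (f := fun e : (ℕ × List α) × (ℕ × List α) × W => do
      let ds ← filter (fun m => eqList eqId m.2.1 e.1.2) B.delta
      map (fun m => do
        tick 1
        pure ((e.1.1, m.1), (e.2.1.1, m.2.2), e.2.2)) ds)
      (B := (n * n * ((S * 2 + 1) + 1) + 1) + (n * n * 2 + 1)) (c := n * n) hT.trans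
      (fun e he => Nat.add_le_add
        -- The source state, as the second list, bounds the comparison; no bound on the letters
        -- stored in `delta` is required.
        (steps_filter_le hB.delta fun m _ => steps_eqList_le (hT.length_source e he) (by simp))
        (steps_map_le (by simpa using hds e) (by simp)))
      (fun e _ => by simpa using hds e)
    simp only [product, steps_bind, steps_pure, val_map, val_bind, val_pure]
    linarith
  · refine ⟨?_, ?_, ?_, ?_⟩ <;> simp only [product, val_bind, val_pure, val_map]
    · exact (length_pairs_le hids hB.states).trans (Nat.le_add_right _ _)
    · exact (length_pairs_le hinits hB.start).trans (Nat.le_add_right _ _)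
    · exact (length_pairs_le hids hB.accept).trans (Nat.le_add_right _ _)
    · refine le_trans ?_ (Nat.le_add_left _ _)
      rw [val_flatMap]
      exact length_flatMap_le hT.trans fun e _ => by simpa using hds e

end Product

/-! ### Tables of cheapest walks -/

section Search

variable {W : Type} [LinearOrder W] [AddCommMonoid W]

/-- A table of at most `n` rows that hold walks of at most `l` nodes. -/
structure Walks.IsBounded (tbl : Walks W) (n l : ℕ) : Prop where
  rows : tbl.length ≤ n
  walks : ∀ e ∈ tbl, ∀ x ∈ e.2, x.2.length ≤ l

variable {tbl : Walks W} {n l : ℕ}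

omit [LinearOrder W] [AddCommMonoid W]

theorem steps_lookup_le (h : tbl.length ≤ n) (v : Node) :
    (lookup tbl v).steps ≤ n * 2 + 1 :=
  steps_find_le h (by simp)

theorem length_lookup_le (h : tbl.IsBounded n l) {v : Node} {x : W × List Node}
    (hx : (lookup tbl v).val = some x) : x.2.length ≤ l := by
  simp only [lookup, val_bind, val_find, val_pure, Option.bind_eq_some_iff] at hx
  obtain ⟨e, he, hx⟩ := hx
  exact h.walks e (List.mem_of_find?_eq_some he) x hx

theorem steps_update_le (h : tbl.length ≤ n) (v : Node) (x : W × List Node) :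
    (update tbl v x).steps ≤ n * 2 + 1 :=
  steps_map_le h (by simp)

theorem Walks.IsBounded.mono {l' : ℕ} (h : tbl.IsBounded n l) (hl : l ≤ l') :
    tbl.IsBounded n l' :=
  ⟨h.rows, fun e he x hx => (h.walks e he x hx).trans hl⟩

theorem Walks.IsBounded.update (h : tbl.IsBounded n l) (v : Node) {x : W × List Node}
    (hx : x.2.length ≤ l) : Walks.IsBounded (update tbl v x).val n l := by
  refine ⟨by simpa [LNC.update] using h.rows, ?_⟩
  simp only [LNC.update, val_map, val_bind, val_pure, List.mem_map, val_eqId]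
  rintro _ ⟨e, he, rfl⟩ y hy
  by_cases hev : e.1 = v
  · simp only [hev, decide_true, if_true, Option.mem_def, Option.some.injEq] at hy
    rwa [← hy]
  · simp only [hev, decide_false, Bool.false_eq_true, if_false] at hy
    exact h.walks e he y hy

end Search

section Relax

variable {W : Type} [LinearOrder W] [AddCommMonoid W] {tbl : Walks W} {n l : ℕ}

/-- A relaxation either keeps the table or enters a stored walk prolonged by one node. -/
theorem Walks.IsBounded.relax (h : tbl.IsBounded n l) (e : Node × Node × W) :
    Walks.IsBounded (relax tbl e).val n (l + 1) := by
  have h' := h.mono (Nat.le_succ l)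
  simp only [LNC.relax, val_bind]
  cases hu : (lookup tbl e.1).val with
  | none => exact h'
  | some x =>
    have hx := Nat.succ_le_succ (length_lookup_le h hu)
    simp only [val_bind]
    cases (lookup tbl e.2.1).val with
    | none => exact h'.update _ hx
    | some y =>
      simp only [val_bind]
      split_ifs
      · exact h'.update _ hx
      · exact h'

theorem steps_relax_le (h : tbl.length ≤ n) (e : Node × Node × W) :
    (relax tbl e).steps ≤ 3 * (n * 2 + 1) + 2 := by
  have h1 := steps_lookup_le h e.1
  have h2 := steps_lookup_le h e.2.1
  have h3 := steps_update_le h e.2.1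
  simp only [LNC.relax, steps_bind]
  cases (lookup tbl e.1).val with
  | none => simp only [steps_pure]; omega
  | some x =>
    simp only [steps_bind]
    have h3 := h3 (x.1 + e.2.2, e.2.1 :: x.2)
    cases (lookup tbl e.2.1).val with
    | none => simp only [steps_bind, steps_tick]; omega
    | some y =>
      simp only [steps_bind, steps_tick]
      split_ifs
      · omega
      · simp only [steps_pure]; omega

variable {P : PBA W} {G : ℕ}

theorem isBounded_foldl_relax (h : tbl.IsBounded n l) (edges : List (Node × Node × W)) :
    Walks.IsBounded (foldl relax tbl edges).val n (l + edges.length) :=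
  foldl_induction (P := fun l tbl => Walks.IsBounded tbl n l) (fun _ _ h e _ => h.relax e) h

/-- The time of a relaxation depends on the number of rows and not on the length of the walks, so
the invariant may forget `l`. -/
theorem steps_foldl_relax_le (h : tbl.IsBounded n l) {edges : List (Node × Node × W)} {E : ℕ}
    (hE : edges.length ≤ E) :
    (foldl relax tbl edges).steps ≤ E * (3 * (n * 2 + 1) + 2 + 1) + 1 :=
  steps_foldl_le (P := fun tbl => ∃ l, Walks.IsBounded tbl n l) hE
    (fun _ ⟨_, h⟩ e _ => ⟨_, h.relax e⟩) (fun _ ⟨_, h⟩ e _ => steps_relax_le h.rows e) ⟨_, h⟩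

omit [LinearOrder W] in
theorem isBounded_cheapest_init {nodes : List Node} (h : nodes.length ≤ n) (src : Node) :
    Walks.IsBounded (map (fun v => do
      let b ← eqId v src
      pure (v, if b then some ((0 : W), [src]) else none)) nodes).val n 1 := by
  refine ⟨by simpa using h, ?_⟩
  simp only [val_map, val_bind, val_pure, val_eqId, List.mem_map]
  rintro _ ⟨v, -, rfl⟩ x hx
  by_cases hv : v = src
  · simp only [hv, decide_true, if_true, Option.mem_def, Option.some.injEq] at hx
    simp [← hx]
  · simp [hv] at hx

/-- The only initial walk has one node, and at most `G` rounds of at most `G` relaxations follow,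
each adding at most one node. This crude count avoids any argument about the shape of cheapest
walks. -/
theorem isBounded_cheapest (hP : P.IsBounded G) (src : Node) :
    Walks.IsBounded (cheapest P src).val G (1 + G * G) := by
  have h := foldl_induction (l := P.nodes) (f := fun t (_ : Node) => foldl relax t P.edges)
    (P := fun k tbl => Walks.IsBounded tbl G (1 + k * P.edges.length))
    (fun k tbl h _ _ => (isBounded_foldl_relax h P.edges).mono (by linarith)) (n := 0)
    ((isBounded_cheapest_init hP.nodes src).mono (by simp))
  rw [zero_add] at h
  exact h.mono (Nat.add_le_add_left (Nat.mul_le_mul hP.nodes hP.edges) 1)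

/-- A bound for the time of `cheapest`. -/
def cheapestSteps (G : ℕ) : ℕ :=
  (G * 2 + 1) + (G * ((G * (3 * (G * 2 + 1) + 2 + 1) + 1) + 1) + 1)

theorem steps_cheapest_le (hP : P.IsBounded G) (src : Node) :
    (cheapest P src).steps ≤ cheapestSteps G :=
  Nat.add_le_add (steps_map_le hP.nodes (by simp))
    (steps_foldl_le (P := fun tbl => ∃ l, Walks.IsBounded tbl G l) hP.nodes
      (fun _ ⟨_, h⟩ _ _ => ⟨_, isBounded_foldl_relax h P.edges⟩)
      (fun _ ⟨_, h⟩ _ _ => steps_foldl_relax_le h hP.edges)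
      ⟨_, isBounded_cheapest_init hP.nodes src⟩)

variable {D : List (Node × Walks W)}

omit [LinearOrder W] [AddCommMonoid W]

theorem length_walk_le (hD : ∀ e ∈ D, Walks.IsBounded e.2 n l) {u v : Node} {x : W × List Node}
    (hx : (walk D u v).val = some x) : x.2.length ≤ l := by
  simp only [walk, val_bind, val_find] at hx
  cases hr : D.find? fun a => (eqId a.1 u).val with
  | none =>
    rw [hr] at hx
    simp at hx
  | some e =>
    rw [hr] at hx
    exact length_lookup_le (hD e (List.mem_of_find?_eq_some hr)) hx

theorem steps_walk_le (hn : D.length ≤ n) (hD : ∀ e ∈ D, Walks.IsBounded e.2 n l) (u v : Node) :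
    (walk D u v).steps ≤ 2 * (n * 2 + 1) := by
  have h1 := steps_find_le (p := fun e : Node × Walks W => eqId e.1 u) (B := 1) hn (by simp)
  simp only [walk, steps_bind, val_find]
  cases hr : D.find? fun a => (eqId a.1 u).val with
  | none => simp only [steps_pure]; omega
  | some e =>
    have := steps_lookup_le (hD e (List.mem_of_find?_eq_some hr)).rows v
    simp only
    omega

theorem steps_component_le (hn : D.length ≤ n) (hD : ∀ e ∈ D, Walks.IsBounded e.2 n l)
    {nodes : List Node} (hnodes : nodes.length ≤ n) (u : Node) :
    (component D nodes u).steps ≤ n * (2 * (2 * (n * 2 + 1)) + 1) + 1 :=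
  steps_find_le hnodes fun v _ => by
    have := steps_walk_le hn hD u v
    have := steps_walk_le hn hD v u
    simp only [steps_bind, steps_pure]
    omega

end Relax

/-! ### The lasso search -/

section Lassos

variable {W : Type} [LinearOrder W] [AddCommMonoid W] {P : PBA W} {G : ℕ}

/-- The tables of cheapest walks from all sources. -/
def allWalks (P : PBA W) : Timed (List (Node × Walks W)) :=
  map (fun v => do
    let t ← cheapest P v
    pure (v, t)) P.nodes

/-- The edges inside the strongly connected components. -/
def innerEdges (P : PBA W) (D : List (Node × Walks W)) : Timed (List (Node × Node × W)) :=
  filter (fun e => do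
    let a ← component D P.nodes e.1
    let b ← component D P.nodes e.2.1
    tick 1
    pure (decide (a = b))) P.edges

/-- The lassos through `f` and one of the edges `out` with a given prefix. -/
def lassosWithPrefix (D : List (Node × Walks W)) (f : Node) (out : List (Node × Node × W))
    (w : W) (pre : List Node) : Timed (List (Lasso W)) :=
  flatMap (fun e => do
    let s ← walk D e.2.1 f
    match s with
    | none => pure []
    | some (w', suf) => do
      let suf' ← reverse suf
      tick 1
      pure [(w + w', pre, suf')]) out

/-- The lassos that start at `i` and pass through `f` and one of the edges `out`. -/
def lassosFrom (D : List (Node × Walks W)) (f : Node) (out : List (Node × Node × W))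
    (i : Node) : Timed (List (Lasso W)) := do
  let p ← walk D i f
  match p with
  | none => pure []
  | some (w, pre) => do
    let pre' ← reverse pre
    lassosWithPrefix D f out w pre'

/-- The lassos through an accepting node `f`. -/
def lassosThrough (P : PBA W) (D : List (Node × Walks W)) (inner : List (Node × Node × W))
    (f : Node) : Timed (List (Lasso W)) := do
  let out ← filter (fun e => eqId e.1 f) inner
  flatMap (lassosFrom D f out) P.start

/-- The nested loops of `lassos` are named one by one, so that each can be bounded separately. -/
theorem lassos_eq (P : PBA W) : lassos P = (do
    let D ← allWalks P
    let inner ← innerEdges P D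
    flatMap (lassosThrough P D inner) P.accept) := rfl

/-- The prefix and the suffix of a lasso have at most `l` nodes. -/
structure Lasso.IsBounded (x : Lasso W) (l : ℕ) : Prop where
  pre : x.2.1.length ≤ l
  suf : x.2.2.length ≤ l

variable {D : List (Node × Walks W)} {l : ℕ}

omit [LinearOrder W] in
theorem lassosWithPrefix_bounds (hn : D.length ≤ G) (hD : ∀ e ∈ D, Walks.IsBounded e.2 G l)
    (f : Node) {out : List (Node × Node × W)} (hout : out.length ≤ G) (w : W) {pre : List Node}
    (hpre : pre.length ≤ l) :
    (lassosWithPrefix D f out w pre).steps ≤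
        G * ((2 * (G * 2 + 1) + ((l * 2 + 1) + 1)) + 1 + 2) + 1 ∧
      (lassosWithPrefix D f out w pre).val.length ≤ G ∧
      ∀ x ∈ (lassosWithPrefix D f out w pre).val, Lasso.IsBounded x l := by
  refine ⟨steps_flatMap_le hout (fun e _ => Nat.add_le_add (steps_walk_le hn hD _ _) ?_)
    fun e _ => ?_, ?_, ?_⟩
  · cases hs : (walk D e.2.1 f).val with
    | none => simp
    | some s => simpa using steps_reverse_le (length_walk_le hD hs)
  · simp only [val_bind]
    cases (walk D e.2.1 f).val <;> simp
  · simp only [lassosWithPrefix, val_flatMap]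
    rw [← mul_one G]
    refine length_flatMap_le hout fun e _ => ?_
    simp only [val_bind]
    cases (walk D e.2.1 f).val <;> simp
  · intro x hx
    simp only [lassosWithPrefix, val_flatMap, List.mem_flatMap, val_bind] at hx
    obtain ⟨e, -, hx⟩ := hx
    cases hs : (walk D e.2.1 f).val with
    | none => simp [hs] at hx
    | some s =>
      simp only [hs, val_bind, val_pure, List.mem_singleton] at hx
      subst hx
      exact ⟨hpre, (length_val_reverse _).le.trans (length_walk_le hD hs)⟩

omit [LinearOrder W] in
theorem lassosFrom_bounds (hn : D.length ≤ G) (hD : ∀ e ∈ D, Walks.IsBounded e.2 G l)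
    (f : Node) {out : List (Node × Node × W)} (hout : out.length ≤ G) (i : Node) :
    (lassosFrom D f out i).steps ≤ 2 * (G * 2 + 1) + ((l * 2 + 1) +
        (G * ((2 * (G * 2 + 1) + ((l * 2 + 1) + 1)) + 1 + 2) + 1)) ∧
      (lassosFrom D f out i).val.length ≤ G ∧
      ∀ x ∈ (lassosFrom D f out i).val, Lasso.IsBounded x l := by
  have hw := steps_walk_le hn hD i f
  simp only [lassosFrom, steps_bind, val_bind]
  cases hp : (walk D i f).val with
  | none =>
    simp only [steps_pure, val_pure, List.length_nil, List.not_mem_nil, IsEmpty.forall_iff,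
      implies_true, and_true, Nat.zero_le]
    omega
  | some p =>
    have hl := length_walk_le hD hp
    have h := lassosWithPrefix_bounds hn hD f hout p.1 ((length_val_reverse p.2).le.trans hl)
    exact ⟨Nat.add_le_add hw (Nat.add_le_add (steps_reverse_le hl) h.1), h.2⟩

/-- There is at most one lasso per accepting node, initial node and outgoing inner edge, hence the
count `G * (G * G)`. The parts of a lasso are reversed table entries, so `isBounded_cheapest` bounds
their lengths. -/
theorem lassos_bounds : ∃ p, PolyBdd p ∧
    ∀ {W : Type} [LinearOrder W] [AddCommMonoid W] (P : PBA W) (G : ℕ), P.IsBounded G →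
      (lassos P).steps ≤ p G ∧ (lassos P).val.length ≤ G * (G * G) ∧
        ∀ x ∈ (lassos P).val, Lasso.IsBounded x (1 + G * G) := by
  refine ⟨fun G => (G * (cheapestSteps G + 1) + 1) +
    ((G * ((2 * (G * (2 * (2 * (G * 2 + 1)) + 1) + 1) + 1) + 1) + 1) +
    (G * (((G * (1 + 1) + 1) + (G * ((2 * (G * 2 + 1) + (((1 + G * G) * 2 + 1) +
        (G * ((2 * (G * 2 + 1) + (((1 + G * G) * 2 + 1) + 1)) + 1 + 2) + 1))) +
        G + 2) + 1)) + G * G + 2) + 1)), by unfold cheapestSteps; fun_prop, ?_⟩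
  intro W _ _ P G hP
  rw [lassos_eq]
  have h1 : (allWalks P).steps ≤ G * (cheapestSteps G + 1) + 1 :=
    steps_map_le hP.nodes fun v _ => steps_cheapest_le hP v
  have hn : (allWalks P).val.length ≤ G := by simpa [allWalks] using hP.nodes
  have hD : ∀ e ∈ (allWalks P).val, Walks.IsBounded e.2 G (1 + G * G) := by
    simp only [allWalks, val_map, val_bind, val_pure, List.mem_map]
    rintro _ ⟨v, -, rfl⟩
    exact isBounded_cheapest hP v
  have h2 : (innerEdges P (allWalks P).val).steps ≤
      G * ((2 * (G * (2 * (2 * (G * 2 + 1)) + 1) + 1) + 1) + 1) + 1 :=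
    steps_filter_le hP.edges fun e _ => by
      have := steps_component_le hn hD hP.nodes e.1
      have := steps_component_le hn hD hP.nodes e.2.1
      simp only [steps_bind, steps_tick, steps_pure]
      linarith
  have hinner : (innerEdges P (allWalks P).val).val.length ≤ G := by
    simp only [innerEdges, val_filter]
    exact (List.length_filter_le _ _).trans hP.edges
  simp only [steps_bind, val_bind, val_flatMap]
  generalize (allWalks P).val = D at *
  generalize (innerEdges P D).val = inner at *
  have hfilter (f : Node) : (filter (fun e => eqId e.1 f) inner).val.length ≤ G := by
    rw [val_filter]
    exact (List.length_filter_le _ _).trans hinner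
  have hthrough (f : Node) : (lassosThrough P D inner f).val.length ≤ G * G := by
    simp only [lassosThrough, val_bind, val_flatMap]
    exact length_flatMap_le hP.start fun i _ =>
      (lassosFrom_bounds hn hD f (hfilter f) i).2.1
  refine ⟨Nat.add_le_add h1 (Nat.add_le_add h2 (steps_flatMap_le hP.accept (fun f _ =>
    Nat.add_le_add (steps_filter_le hinner (by simp)) (steps_flatMap_le hP.start
      (fun i _ => (lassosFrom_bounds hn hD f (hfilter f) i).1)
      fun i _ => (lassosFrom_bounds hn hD f (hfilter f) i).2.1)) fun f _ => hthrough f)), ?_, ?_⟩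
  · exact length_flatMap_le hP.accept fun f _ => hthrough f
  · intro x hx
    simp only [List.mem_flatMap, lassosThrough, val_bind, val_flatMap] at hx
    obtain ⟨f, -, i, -, hx⟩ := hx
    exact (lassosFrom_bounds hn hD f (hfilter f) i).2.2 x hx

omit [AddCommMonoid W] in
-- Optimality plays no role; membership suffices to carry the length bounds over to the chosen
-- lasso.
theorem mem_of_best_eq_some {L : List (Lasso W)} {x : Lasso W} (h : (best L).val = some x) :
    x ∈ L := by
  refine foldl_induction (P := fun _ (b : Option (Lasso W)) => ∀ x, b = some x → x ∈ L)
    (n := 0) (l := L) (c := none) ?_ (by simp) x h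
  intro _ b hb a ha y hy
  cases b with
  | none =>
    simp only [val_bind, val_pure, Option.some.injEq] at hy
    rwa [← hy]
  | some z =>
    simp only [val_bind, val_pure] at hy
    split_ifs at hy
    · rwa [← Option.some.inj hy]
    · exact hb y hy

omit [AddCommMonoid W] in
theorem steps_best_le {L : List (Lasso W)} {n : ℕ} (h : L.length ≤ n) :
    (best L).steps ≤ n * 2 + 1 :=
  steps_foldl_le' h (fun b a _ => by cases b <;> simp) none

end Lassos

/-! ### The complete planner -/

section Plan

/-- The prefix and the suffix of a plan consist of at most `n` sets of at most `n` elements. -/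
structure Plan.IsBounded {α : Type} (q : Plan α) (n : ℕ) : Prop where
  pre : q.pre.length ≤ n
  suf : q.suf.length ≤ n
  length_pre : ∀ A ∈ q.pre, A.length ≤ n
  length_suf : ∀ A ∈ q.suf, A.length ≤ n

variable {α W : Type} {T : WTS α W} {S n : ℕ}

theorem length_project (T : WTS α W) (w : List Node) : (project T w).val.length = w.length := by
  simp [project]

theorem length_le_of_mem_project (hT : T.IsBounded S) {w : List Node} {A : List α}
    (hA : A ∈ (project T w).val) : A.length ≤ S := by
  simp only [project, val_map, val_bind, val_find, val_pure, List.mem_map] at hA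
  obtain ⟨v, -, rfl⟩ := hA
  cases hq : T.states.find? fun q => (eqId q.1 v.1).val with
  | none => simp
  | some q => simpa using hT.length_state q (List.mem_of_find?_eq_some hq)

theorem steps_project_le (hT : T.IsBounded S) {w : List Node} (hw : w.length ≤ n) :
    (project T w).steps ≤ n * ((S * (1 + 1) + 1) + 1) + 1 :=
  steps_map_le hw fun _ _ => steps_find_le hT.states (by simp)

/-- The stages are chained, the output size of each being the input size of the next. The size of
the resulting plan is bounded as well, because command nodes later compare such plans. -/
theorem plan_bounds : ∃ p, PolyBdd p ∧ ∀ {α W : Type} [DecidableEq α] [LinearOrder W]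
    [AddCommMonoid W] (AP : List α) (φ : LTL α) (start : Finset α → Bool)
    (cost : Finset α → Finset α → W) (S : ℕ), 2 ^ AP.length ≤ S → φ.size ≤ S → φ.width ≤ S →
      (plan AP φ start cost).steps ≤ p S ∧
        ∀ q, (plan AP φ start cost).val = some q → q.IsBounded (p S) := by
  obtain ⟨pT, hpT, hT⟩ := transitionSystem_bounds
  obtain ⟨pB, hpB, hB⟩ := buchi_bounds
  obtain ⟨pP, hpP, hP⟩ := product_bounds
  obtain ⟨pL, hpL, hL⟩ := lassos_bounds
  obtain ⟨g, hg, hP'⟩ : ∃ g, PolyBdd g ∧ ∀ S, productSize S (buchiSize S) = g S := by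
    refine ⟨_, ?_, fun S => rfl⟩
    have := polyBdd_buchiSize
    unfold productSize
    fun_prop
  obtain ⟨pS, hpS, hS'⟩ : ∃ p, PolyBdd p ∧ ∀ S, pP S (buchiSize S) = p S :=
    ⟨_, hpP _ polyBdd_buchiSize, fun _ => rfl⟩
  refine ⟨fun S => pT S + (pB S + (pS S + (pL (g S) +
    ((g S * (g S * g S) * 2 + 1) + (((1 + g S * g S) * ((S * (1 + 1) + 1) + 1) + 1) +
      ((1 + g S * g S) * ((S * (1 + 1) + 1) + 1) + 1)))))), by fun_prop, ?_⟩
  intro α W _ _ _ AP φ start cost S hS hφ hw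
  obtain ⟨hT1, hT2⟩ := hT AP start cost S hS
  obtain ⟨hB1, hB2⟩ := hB AP φ S hS hφ hw
  simp only [plan, steps_bind, val_bind]
  generalize (transitionSystem AP start cost).val = T at *
  generalize (buchi AP φ).val = B at *
  obtain ⟨hP1, hP2⟩ := hP T B S _ hT2 hB2
  rw [hP'] at hP2
  rw [hS'] at hP1
  generalize (product T B).val = P at *
  obtain ⟨hL1, hL2, hL3⟩ := hL P _ hP2
  generalize (lassos P).val = L at *
  have hbest := steps_best_le hL2
  cases hx : (best L).val with
  | none =>
    refine ⟨?_, by simp⟩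
    simp only [steps_pure]
    omega
  | some x =>
    have hx := hL3 x (mem_of_best_eq_some hx)
    refine ⟨Nat.add_le_add hT1 <| Nat.add_le_add hB1 <| Nat.add_le_add hP1 <|
      Nat.add_le_add hL1 <| Nat.add_le_add hbest <| Nat.add_le_add
      (steps_project_le hT2 hx.pre) (steps_project_le hT2 hx.suf), ?_⟩
    rintro q hq
    simp only [val_bind, val_pure, Option.some.injEq] at hq
    subst hq
    -- The summand of `p S` that pays for a projection already exceeds both the length of the walk
    -- and the size of a state, hence `p S` also bounds the plan.
    have h1 : 1 + g S * g S ≤ (1 + g S * g S) * ((S * (1 + 1) + 1) + 1) :=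
      Nat.le_mul_of_pos_right _ (by omega)
    have h2 : S ≤ (1 + g S * g S) * ((S * (1 + 1) + 1) + 1) :=
      le_trans (by omega) (Nat.le_mul_of_pos_left _ (by omega))
    refine ⟨?_, ?_, fun A hA => ?_, fun A hA => ?_⟩
    · rw [length_project]
      exact hx.pre.trans (by omega)
    · rw [length_project]
      exact hx.suf.trans (by omega)
    · exact (length_le_of_mem_project hT2 hA).trans (by omega)
    · exact (length_le_of_mem_project hT2 hA).trans (by omega)

end Plan

/-! ### Size and width of the specifications -/

namespace LTL

variable {α : Type} {l : List (LTL α)} {n s w : ℕ}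

@[simp] theorem steps_conj (l : List (LTL α)) : (conj l).steps = l.length + 1 := by
  induction l with
  | nil => simp [conj]
  | cons f l ih => simp [conj, ih]; omega

theorem size_conj_le (hl : l.length ≤ n) (h : ∀ f ∈ l, f.size ≤ s) :
    (conj l).val.size ≤ n * (s + 1) + 1 := by
  suffices (conj l).val.size ≤ l.length * (s + 1) + 1 from this.trans (by gcongr)
  clear hl
  induction l with
  | nil => simp [conj, size]
  | cons f l ih =>
    have h1 := h f (by simp)
    have h2 := ih fun g hg => h g (by simp [hg])
    simp only [conj, val_bind, val_pure, size, List.length_cons]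
    linarith

/-- Labellings of the conjuncts are chosen independently, so widths multiply: here the exponential
in the number of propositions arises. -/
theorem width_conj_le (hw : 0 < w) (hl : l.length ≤ n) (h : ∀ f ∈ l, f.width ≤ w) :
    (conj l).val.width ≤ w ^ n := by
  refine le_trans ?_ (Nat.pow_le_pow_right hw hl)
  clear hl
  induction l with
  | nil => simp [conj, width]
  | cons f l ih =>
    have h1 := h f (by simp)
    have h2 := ih fun g hg => h g (by simp [hg])
    simp only [conj, val_bind, val_pure, width, List.length_cons, pow_succ']
    exact Nat.mul_le_mul h1 h2

/-- The specification that whenever `a` is active, the members of `nbrs` are not, and that `a` is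
active infinitely often. -/
def activation (a : α) (nbrs : List α) : Timed (LTL α) := do
  let negs ← map (fun b => do
    tick 1
    pure (LTL.not (LTL.atom b))) nbrs
  let g ← conj negs
  pure (LTL.and (LTL.always (LTL.imp (LTL.atom a) g))
    (LTL.always (LTL.eventually (LTL.atom a))))

variable {nbrs : List α}

theorem steps_activation_le (a : α) (h : nbrs.length ≤ n) :
    (activation a nbrs).steps ≤ n * 3 + 2 := by
  have := steps_map_le (f := fun b : α => do tick 1; pure (LTL.not (LTL.atom b))) (B := 1) h
    (by simp)
  simp only [activation, steps_bind, steps_conj, val_map, List.length_map, steps_pure]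
  omega

theorem size_activation_le (a : α) (h : nbrs.length ≤ n) :
    (activation a nbrs).val.size ≤ n * 3 + 17 := by
  have := size_conj_le (l := nbrs.map fun b => LTL.not (LTL.atom b)) (s := 2) (by simpa using h)
    (by simp [size])
  simp only [activation, val_bind, val_map, val_pure, size, always, imp, eventually]
  omega

/-- The safety part contains one until and the recurrence part two; the conjunction of negated atoms
has width 1 whatever the number of neighbours. Hence `8 = 2 ^ 3`. -/
theorem width_activation_le (a : α) (nbrs : List α) : (activation a nbrs).val.width ≤ 8 := by
  have := width_conj_le (l := nbrs.map fun b => LTL.not (LTL.atom b)) (w := 1) (n := nbrs.length)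
    one_pos (by simp) (by simp [width])
  simp only [activation, val_bind, val_map, val_pure, width, always, imp, eventually]
  rw [one_pow] at this
  omega

/-- A bound for the size of a specification of `n` propositions, in terms of `u = 8 ^ n`. -/
def specSize (u : ℕ) : ℕ := u * (u * u * 3 + 18) + 1

/-- A conjunction of activation specifications is not too large. -/
theorem conj_activation_bounds {β : Type} {AP : List β} {nbrs : β → List α} {a : β → α}
    (hAP : AP.length ≤ n) (h : ∀ b ∈ AP, (nbrs b).length ≤ n * n) :
    2 ^ AP.length ≤ specSize (8 ^ n) ∧
      (conj (AP.map fun b => (activation (a b) (nbrs b)).val)).val.size ≤ specSize (8 ^ n) ∧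
      (conj (AP.map fun b => (activation (a b) (nbrs b)).val)).val.width ≤ specSize (8 ^ n) := by
  have hn : n ≤ 8 ^ n := (Nat.lt_pow_self (by norm_num)).le
  have hu : 8 ^ n ≤ specSize (8 ^ n) :=
    (Nat.le_mul_of_pos_right _ (by omega)).trans (Nat.le_succ _)
  have hl : (AP.map fun b => (activation (a b) (nbrs b)).val).length ≤ n := by simpa using hAP
  refine ⟨?_, ?_, ?_⟩
  · refine le_trans ?_ hu
    calc 2 ^ AP.length ≤ 2 ^ n := Nat.pow_le_pow_right two_pos hAP
      _ ≤ 8 ^ n := Nat.pow_le_pow_left (by norm_num) n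
  · refine (size_conj_le hl (s := n * n * 3 + 17) ?_).trans ?_
    · simp only [List.mem_map]
      rintro _ ⟨b, hb, rfl⟩
      exact size_activation_le _ (h b hb)
    · change n * (n * n * 3 + 18) + 1 ≤ _
      unfold specSize
      gcongr
  · refine (width_conj_le (w := 8) (by norm_num) hl ?_).trans hu
    simp only [List.mem_map]
    rintro _ ⟨b, -, rfl⟩
    exact width_activation_le _ _

theorem polyBdd_specSize : PolyBdd specSize := by
  unfold specSize
  fun_prop

end LTL

theorem linkSpec_eq {N : ℕ} (links : List (Link N)) : linkSpec links = (do
    let parts ← map (fun e => do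
      let nbrs ← filter (interferes e) links
      LTL.activation e nbrs) links
    LTL.conj parts) := rfl

theorem centralized_bounds : ∃ p, PolyBdd p ∧ ∀ {N : ℕ} (links : List (Link N))
    (start : Finset (Link N) → Bool) (cost : Finset (Link N) → Finset (Link N) → ℝ≥0) (n : ℕ),
    links.length ≤ n → (centralized links start cost).steps ≤ p (8 ^ n) := by
  obtain ⟨p, hp, h⟩ := plan_bounds
  have hs := LTL.polyBdd_specSize
  refine ⟨fun u => ((u * (((u * 7 + 1) + (u * 3 + 2)) + 1) + 1) + (u + 1)) + p (LTL.specSize u),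
    by fun_prop, ?_⟩
  intro N links start cost n hn
  have hnbrs (e : Link N) : (filter (interferes e) links).val.length ≤ n := by
    rw [val_filter]
    exact (List.length_filter_le _ _).trans hn
  -- The lemma admits `n * n` neighbours for the sake of the command graph, whose list is bounded by
  -- `K * K`; a link has at most `n`.
  obtain ⟨h1, h2, h3⟩ := LTL.conj_activation_bounds (a := fun e : Link N => e) hn
    (nbrs := fun e => (filter (interferes e) links).val) fun e _ =>
      (hnbrs e).trans (Nat.le_mul_self n)
  have hu : n ≤ 8 ^ n := (Nat.lt_pow_self (by norm_num)).le
  simp only [centralized, linkSpec_eq, steps_bind, val_bind, val_map, LTL.steps_conj,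
    List.length_map]
  refine Nat.add_le_add (Nat.add_le_add (steps_map_le (hn.trans hu) fun e _ =>
    Nat.add_le_add (steps_filter_le (hn.trans hu) fun e' _ => ?_)
    (LTL.steps_activation_le _ ((hnbrs e).trans hu))) (Nat.succ_le_succ (hn.trans hu)))
    (h _ _ _ _ _ h1 h2 h3).1
  simp [interferes]

/-! ### Counting links and the covering argument -/

section Graph

variable {d N K : ℕ}

theorem nodup_linkList (G : SimpleGraph (Fin N)) : (linkList G).Nodup :=
  ((List.nodup_finRange N).product (List.nodup_finRange N)).filter _

theorem mem_linkList {G : SimpleGraph (Fin N)} {e : Link N} :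
    e ∈ linkList G ↔ e.1 < e.2 ∧ G.Adj e.1 e.2 := by
  obtain ⟨i, i'⟩ := e
  simp [linkList, List.pair_mem_product]

/-- On ordered pairs with increasing entries, passing to the unordered pair is injective, as the
order excludes the swapped pair. -/
theorem length_le_ncard_of_forall_mem {l : List (Link N)} (hl : l.Nodup)
    (hlt : ∀ e ∈ l, e.1 < e.2) {s : Set (Sym2 (Fin N))} (h : ∀ e ∈ l, s(e.1, e.2) ∈ s) :
    l.length ≤ s.ncard := by
  rw [← List.toFinset_card_of_nodup hl, ← Set.ncard_coe_finset]
  refine Set.ncard_le_ncard_of_injOn (fun e => s(e.1, e.2)) (by simpa using h) ?_ s.toFinite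
  intro e he e' he' hee
  have h1 := hlt e (by simpa using he)
  have h2 := hlt e' (by simpa using he')
  simp only [Sym2.eq_iff] at hee
  rcases hee with h | h
  · exact Prod.ext h.1 h.2
  · rw [h.1, h.2] at h1
    exact absurd h1 h2.asymm

theorem length_linkList_le (G : SimpleGraph (Fin N)) : (linkList G).length ≤ G.edgeSet.ncard :=
  length_le_ncard_of_forall_mem (nodup_linkList G) (fun _ he => (mem_linkList.1 he).1)
    fun _ he => (mem_linkList.1 he).2

@[simp] theorem val_inRange (R : ℝ) (p q : EuclideanSpace ℝ (Fin d)) :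
    (inRange R p q).val = true ↔ ‖p - q‖ ≤ R := by
  simp [inRange]

@[simp] theorem steps_inRange (R : ℝ) (p q : EuclideanSpace ℝ (Fin d)) :
    (inRange R p q).steps = d + 1 := rfl

variable (x : Fin N → EuclideanSpace ℝ (Fin d)) (c : Fin K → EuclideanSpace ℝ (Fin d)) (r R : ℝ)

theorem mem_localLinks {p : EuclideanSpace ℝ (Fin d)} {links : List (Link N)} {e : Link N} :
    e ∈ (localLinks x R p links).val ↔ e ∈ links ∧ ‖x e.1 - p‖ ≤ R ∧ ‖x e.2 - p‖ ≤ R := by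
  simp [localLinks, List.mem_filter]

/-- Both endpoints of a local link are in range, so it comes from an edge of the induced subgraph;
the inclusion of the vertices is injective on edges. -/
theorem length_localLinks_le (j : Fin K) :
    (localLinks x R (c j) (linkList (sensorGraph x r))).val.length ≤ eMax x c r R := by
  have h : (localLinks x R (c j) (linkList (sensorGraph x r))).val.length ≤
      (Sym2.map Subtype.val '' (commandSubgraph x r R (c j)).edgeSet).ncard := by
    refine length_le_ncard_of_forall_mem ?_ (fun e he => ?_) fun e he => ?_
    · rw [localLinks, val_filter]
      exact (nodup_linkList _).filter _
    · exact (mem_linkList.1 ((mem_localLinks x R).1 he).1).1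
    · obtain ⟨he, h1, h2⟩ := (mem_localLinks x R).1 he
      exact ⟨s(⟨e.1, h1⟩, ⟨e.2, h2⟩), (mem_linkList.1 he).2, rfl⟩
  rw [Set.ncard_image_of_injective _ (Sym2.map.injective Subtype.val_injective)] at h
  exact h.trans (Finset.le_sup (f := fun j => (commandSubgraph x r R (c j)).edgeSet.ncard)
    (Finset.mem_univ j))

/-- If one endpoint of a link is within `R - ε` of a command node, the other is within `R - ε + r <
R`. Each link therefore occurs in one of the `K` local lists. -/
theorem length_linkList_le_mul_eMax
    (h : ∃ ε ∈ Set.Ioo r R, Set.range x ⊆ ⋃ j, Metric.ball (c j) (R - ε)) :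
    (linkList (sensorGraph x r)).length ≤ K * eMax x c r R := by
  classical
  obtain ⟨ε, hε, hx⟩ := h
  let L (j : Fin K) := (localLinks x R (c j) (linkList (sensorGraph x r))).val
  have hsub : (linkList (sensorGraph x r)).toFinset ⊆
      Finset.univ.biUnion fun j => (L j).toFinset := by
    intro e he
    rw [List.mem_toFinset] at he
    obtain ⟨j, hj⟩ := Set.mem_iUnion.1 (hx ⟨e.1, rfl⟩)
    rw [Metric.mem_ball, dist_eq_norm] at hj
    have hadj := (mem_linkList.1 he).2.2
    have h2 : ‖x e.2 - c j‖ ≤ ‖x e.1 - x e.2‖ + ‖x e.1 - c j‖ := by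
      rw [norm_sub_rev (x e.1) (x e.2)]
      exact norm_sub_le_norm_sub_add_norm_sub _ _ _
    -- The length of the link is nonnegative and at most `r`, which makes `ε` positive and puts the
    -- first endpoint in range too.
    have hn := norm_nonneg (x e.1 - x e.2)
    simp only [Finset.mem_biUnion, Finset.mem_univ, true_and, List.mem_toFinset]
    exact ⟨j, (mem_localLinks x R).2 ⟨he, by linarith [hε.1], by linarith [hε.1]⟩⟩
  rw [← List.toFinset_card_of_nodup (nodup_linkList _)]
  refine (Finset.card_le_card hsub).trans ((Finset.card_biUnion_le_card_mul _ _ _ fun j _ =>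
    (List.toFinset_card_le _).trans (length_localLinks_le x c r R j)).trans ?_)
  simp

end Graph

/-! ### The command nodes and the hierarchical planner -/

section Command

variable {d N K : ℕ}

/-- Only the values agree: `commandSpec` reads the neighbours off the links without first listing
them, so its steps are counted separately. -/
theorem commandSpec_eq (cmd : List (Fin K × Fin K)) : (commandSpec cmd).val =
    (LTL.conj ((List.finRange K).map fun j => (LTL.activation j
      ((cmd.filter fun e => (eqId e.1 j).val).map Prod.snd)).val)).val := by
  simp [commandSpec, LTL.activation, Function.comp_def]

theorem steps_commandSpec_le {cmd : List (Fin K × Fin K)} {m : ℕ} (h : cmd.length ≤ m) :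
    (commandSpec cmd).steps ≤
      (K * (((m * 2 + 1) + ((m * 2 + 1) + (m + 1))) + 1) + 1) + (K + 1) := by
  have hf (j : Fin K) : (filter (fun e => eqId e.1 j) cmd).val.length ≤ m := by
    rw [val_filter]
    exact (List.length_filter_le _ _).trans h
  simp only [commandSpec, steps_bind, LTL.steps_conj, val_map, List.length_map,
    List.length_finRange]
  refine Nat.add_le_add (steps_map_le (by simp) fun j _ => ?_) le_rfl
  exact Nat.add_le_add (steps_filter_le h (by simp)) (Nat.add_le_add
    (steps_map_le (hf j) (by simp)) (by simpa using hf j))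

theorem commandPlan_bounds : ∃ p, PolyBdd p ∧ ∀ {K : ℕ} (cmd : List (Fin K × Fin K))
    (start : Finset (Fin K) → Bool), cmd.length ≤ K * K →
      (commandPlan cmd start).steps ≤ p (8 ^ K) ∧
        ∀ q, (commandPlan cmd start).val = some q → q.IsBounded (p (8 ^ K)) := by
  obtain ⟨p, hp, h⟩ := plan_bounds
  have hs := LTL.polyBdd_specSize
  refine ⟨fun u => ((u * (((u * u * 2 + 1) + ((u * u * 2 + 1) + (u * u + 1))) + 1) + 1) +
    (u + 1)) + p (LTL.specSize u), by fun_prop, ?_⟩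
  intro K cmd start hcmd
  obtain ⟨h1, h2, h3⟩ := LTL.conj_activation_bounds (AP := List.finRange K) (n := K)
    (a := fun j => j) (nbrs := fun j => (cmd.filter fun e => (eqId e.1 j).val).map Prod.snd)
    (by simp) fun j _ => by simpa using (List.length_filter_le _ _).trans hcmd
  rw [← commandSpec_eq] at h2 h3
  obtain ⟨h4, h5⟩ := h (List.finRange K) _ start (fun _ _ => (0 : ℝ≥0)) _ h1 h2 h3
  have hu : K ≤ 8 ^ K := (Nat.lt_pow_self (by norm_num)).le
  constructor
  · refine Nat.add_le_add ((steps_commandSpec_le hcmd).trans ?_) h4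
    gcongr
  · intro q hq
    have hq := h5 q hq
    have hle := Nat.le_add_left (p (LTL.specSize (8 ^ K))) ((8 ^ K * (((8 ^ K * 8 ^ K * 2 + 1) +
      ((8 ^ K * 8 ^ K * 2 + 1) + (8 ^ K * 8 ^ K + 1))) + 1) + 1) + (8 ^ K + 1))
    exact ⟨hq.pre.trans hle, hq.suf.trans hle, fun A hA => (hq.length_pre A hA).trans hle,
      fun A hA => (hq.length_suf A hA).trans hle⟩

theorem commandGraph_bounds (c : Fin K → EuclideanSpace ℝ (Fin d)) (R : ℝ) :
    (commandGraph c R).steps ≤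
        (K * ((K * 2 + 1) + K + 2) + 1) + (K * K * ((1 + (d + 1)) + 1) + 1) ∧
      (commandGraph c R).val.length ≤ K * K := by
  have hK : (List.finRange K).length ≤ K := by simp
  refine ⟨Nat.add_le_add (steps_pairs_le hK hK) (steps_filter_le (length_pairs_le hK hK)
    (by simp)), ?_⟩
  simp only [commandGraph, val_bind, val_filter]
  exact (List.length_filter_le _ _).trans (length_pairs_le hK hK)

theorem steps_eqPlan_le (ρ ρ' : Option (Plan (Fin K))) {n : ℕ}
    (h : ∀ q, ρ' = some q → q.IsBounded n) :
    (eqPlan ρ ρ').steps ≤ 1 + 2 * (n * ((n * 2 + 1) + 1) + 1) := by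
  cases ρ' with
  | none => cases ρ <;> simp [eqPlan]
  | some q =>
    cases ρ with
    | none => simp [eqPlan]
    | some q' =>
      have h := h q rfl
      have h1 := steps_eqList_le (eq := eqList eqId) (k := q'.pre) (B := n * 2 + 1) h.pre (fun a b hb =>
        steps_eqList_le (eq := eqId) (k := a) (B := 1) (h.length_pre b hb) (by simp))
      have h2 := steps_eqList_le (eq := eqList eqId) (k := q'.suf) (B := n * 2 + 1) h.suf (fun a b hb =>
        steps_eqList_le (eq := eqId) (k := a) (B := 1) (h.length_suf b hb) (by simp))
      simp only [eqPlan, steps_bind, steps_tick, steps_pure]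
      omega

/-- A bound for the time of `consensus` with at most `K` plans of size at most `n`. -/
def consensusSteps (K n : ℕ) : ℕ :=
  K * (((K * K * 3 + 1) + (1 + 2 * (n * ((n * 2 + 1) + 1) + 1))) + 1) + 1

/-- The held plan is the second argument of `eqPlan` and bounds the comparison alone, so nothing is
assumed about the current plan. -/
theorem steps_consensus_le {cmd : List (Fin K × Fin K)} (hcmd : cmd.length ≤ K * K) (j : Fin K)
    (ρ : Option (Plan (Fin K))) {held : List (Fin K × Option (Plan (Fin K)))} {n : ℕ}
    (hheld : held.length ≤ K) (h : ∀ e ∈ held, ∀ q, e.2 = some q → q.IsBounded n) :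
    (consensus cmd j ρ held).steps ≤ consensusSteps K n := by
  refine steps_foldl_le' hheld (fun ρ' e he => ?_) ρ
  have h1 := steps_any_le (p := fun e' : Fin K × Fin K => do
    let a ← eqId e'.1 j
    let b ← eqId e'.2 e.1
    pure (a && b)) (B := 2) hcmd (by simp)
  have h2 := steps_eqPlan_le ρ' e.2 (h e he)
  refine Nat.add_le_add h1 ?_
  dsimp only
  split_ifs
  · simpa using h2
  · simp

/-- The result is the node's own plan or one of the held ones, so the same size bound survives every
round of the hierarchical loop. -/
theorem isBounded_of_consensus_eq_some {cmd : List (Fin K × Fin K)} {j : Fin K}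
    {ρ : Option (Plan (Fin K))} {held : List (Fin K × Option (Plan (Fin K)))} {n : ℕ}
    (hρ : ∀ q, ρ = some q → q.IsBounded n)
    (h : ∀ e ∈ held, ∀ q, e.2 = some q → q.IsBounded n) :
    ∀ q, (consensus cmd j ρ held).val = some q → q.IsBounded n := by
  refine foldl_induction (P := fun _ (ρ : Option (Plan (Fin K))) =>
    ∀ q, ρ = some q → q.IsBounded n) (n := 0) (fun _ ρ' hρ' e he => ?_) hρ
  simp only [val_bind]
  split_ifs
  · simp only [val_bind, val_pure]
    split_ifs
    · exact hρ'
    · exact h e he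
  · exact hρ'

theorem steps_localLinks_le (x : Fin N → EuclideanSpace ℝ (Fin d)) (R : ℝ)
    (p : EuclideanSpace ℝ (Fin d)) {links : List (Link N)} {n : ℕ} (h : links.length ≤ n) :
    (localLinks x R p links).steps ≤ n * (2 * (d + 1) + 1) + 1 :=
  steps_filter_le h fun e _ => by simp [two_mul]

theorem hierarchical_bounds (d : ℕ) : ∃ p, PolyBdd p ∧ ∀ {N K : ℕ} (links : List (Link N))
    (x : Fin N → EuclideanSpace ℝ (Fin d)) (c : Fin K → EuclideanSpace ℝ (Fin d)) (R : ℝ)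
    (start : Finset (Link N) → Bool) (cmdStart : Finset (Fin K) → Bool)
    (cost : Finset (Link N) → Finset (Link N) → ℝ≥0) (n : ℕ), links.length ≤ K * n →
    (∀ j, (localLinks x R (c j) links).val.length ≤ n) →
    (hierarchical links x c R start cmdStart cost).steps ≤ p (8 ^ (n + K)) := by
  obtain ⟨p₁, hp₁, h₁⟩ := commandPlan_bounds
  obtain ⟨p₂, hp₂, h₂⟩ := centralized_bounds
  obtain ⟨q₁, hq₁, hm₁, hle₁⟩ := hp₁.exists_monotone
  obtain ⟨q₂, hq₂, hm₂, hle₂⟩ := hp₂.exists_monotone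
  refine ⟨fun v => ((v * ((v * 2 + 1) + v + 2) + 1) + (v * v * ((1 + (d + 1)) + 1) + 1)) +
    (v * ((q₁ v + ((v * 2 + 1) + (consensusSteps v (q₁ v) + ((v * v * (2 * (d + 1) + 1) + 1) +
      (q₂ v + 1))))) + 1) + 1), by unfold consensusSteps; fun_prop, ?_⟩
  intro N K links x c R start cmdStart cost n hlinks hlocal
  have hv₁ : 8 ^ K ≤ 8 ^ (n + K) := Nat.pow_le_pow_right (by norm_num) (by omega)
  have hv₂ : 8 ^ n ≤ 8 ^ (n + K) := Nat.pow_le_pow_right (by norm_num) (by omega)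
  have hK : K ≤ 8 ^ (n + K) := (Nat.lt_pow_self (by norm_num)).le.trans hv₁
  have hn : n ≤ 8 ^ (n + K) := (Nat.lt_pow_self (by norm_num)).le.trans hv₂
  obtain ⟨hg1, hg2⟩ := commandGraph_bounds c R
  obtain ⟨hc1, hc2⟩ := h₁ _ cmdStart hg2
  simp only [hierarchical, steps_bind]
  refine Nat.add_le_add (hg1.trans (by gcongr)) ?_
  have hheld {m : ℕ} {out : HierarchicalPlan N K}
      (h : ∀ e ∈ out, ∀ q, e.2.1 = some q → q.IsBounded m) : ∀ e ∈ (map (fun h => do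
        tick 1
        pure (h.1, h.2.1)) out).val, ∀ q, e.2 = some q → q.IsBounded m := by
    simp only [val_map, val_bind, val_pure, List.mem_map]
    rintro _ ⟨e, he, rfl⟩
    exact h e he
  -- After `m` rounds there are `m` entries, and all activation plans in them obey the bound for a
  -- single run of `commandPlan`, independent of `m`.
  refine steps_foldl_le_of_induction (P := fun m (out : HierarchicalPlan N K) =>
    out.length = m ∧ ∀ e ∈ out, ∀ q, e.2.1 = some q → q.IsBounded (p₁ (8 ^ K)))
    (n := K) (by simp) ?_ ?_ (by simp) |>.trans (by gcongr)
  · rintro m out ⟨hlen, hout⟩ j -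
    refine ⟨by simp [hlen], ?_⟩
    simp only [val_bind, val_pure, List.mem_cons]
    rintro e (rfl | he)
    · exact isBounded_of_consensus_eq_some hc2 (hheld hout)
    · exact hout e he
  · rintro m out hm ⟨hlen, hout⟩ j -
    refine Nat.add_le_add (hc1.trans ((hle₁ _).trans (hm₁ hv₁))) <| Nat.add_le_add
      ((steps_map_le (B := 1) (hlen.le.trans hm) (by simp)).trans (by gcongr)) <|
      Nat.add_le_add ((steps_consensus_le hg2 j _ (by simpa using hlen.le.trans hm)
        (hheld hout)).trans ?_) <|
      Nat.add_le_add ((steps_localLinks_le x R (c j) hlinks).trans (by gcongr)) <|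
      Nat.add_le_add ((h₂ _ _ _ n (hlocal j)).trans ((hle₂ _).trans (hm₂ hv₂))) (by simp)
    have := (hle₁ (8 ^ K)).trans (hm₁ hv₁)
    unfold consensusSteps
    gcongr

end Command

end LNC

theorem mainTheorem3 (d : ℕ) :
    (∃ C a b : ℕ, ∀ (N K : ℕ) (x : Fin N → EuclideanSpace ℝ (Fin d))
      (c : Fin K → EuclideanSpace ℝ (Fin d)) (r R : ℝ)
      (start : Finset (LNC.Link N) → Bool) (cmdStart : Finset (Fin K) → Bool)
      (cost : Finset (LNC.Link N) → Finset (LNC.Link N) → ℝ≥0),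
      0 < r → 0 < K →
      (∃ ε ∈ Set.Ioo r R, Set.range x ⊆ ⋃ j, Metric.ball (c j) (R - ε)) →
      (LNC.hierarchical (LNC.linkList (LNC.sensorGraph x r)) x c R start cmdStart cost).steps ≤
        C * (K * 2 ^ (a * LNC.eMax x c r R + b * K))) ∧
    (∃ C a : ℕ, ∀ (N : ℕ) (x : Fin N → EuclideanSpace ℝ (Fin d)) (r : ℝ)
      (start : Finset (LNC.Link N) → Bool)
      (cost : Finset (LNC.Link N) → Finset (LNC.Link N) → ℝ≥0),
      0 < r →
      (LNC.centralized (LNC.linkList (LNC.sensorGraph x r)) start cost).steps ≤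
        C * 2 ^ (a * (LNC.sensorGraph x r).edgeSet.ncard)) := by
  constructor
  · obtain ⟨p, hp, h⟩ := LNC.hierarchical_bounds d
    obtain ⟨C, a, hC⟩ := hp.apply_eight_pow_le
    -- One exponent serves for both `a` and `b`, since the bound is a polynomial in `8 ^ (eMax +
    -- K)`. The `K` rounds are absorbed there, so the factor `K` in the claim only needs `K ≥ 1`.
    refine ⟨C, a, a, fun N K x c r R start cmdStart cost _ hK hcover => ?_⟩
    refine (h _ x c R start cmdStart cost _ (LNC.length_linkList_le_mul_eMax x c r R hcover)
      (LNC.length_localLinks_le x c r R)).trans ((hC _).trans (Nat.mul_le_mul_left C ?_))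
    rw [mul_add]
    exact Nat.le_mul_of_pos_left _ hK
  · obtain ⟨p, hp, h⟩ := LNC.centralized_bounds
    obtain ⟨C, a, hC⟩ := hp.apply_eight_pow_le
    exact ⟨C, a, fun N x r start cost _ =>
      (h _ start cost _ (LNC.length_linkList_le _)).trans (hC _)⟩
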